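/- Let $(K,v)$ be a non-trivially valued, algebraically closed field of characteristic $0$, with (additive) value group $\Gamma_K$ and maximal ideal $\mathcal{M}_K$, and let $(K,\mathcal{L})$ be an expansion of the structure $(K;+,-,\cdot,0,1,\mathrm{div})$, where $\mathrm{div}(x,y)$ means $v(x)\le v(y)$. "Definable" means $\mathcal{L}$-definable with parameters; a function $g\colon\Gamma_K\to\Gamma_K$ is definable if $\{(x,y)\in (K^\times)^2: v(y)=g(v(x))\}$ is. Open balls are the sets $\{x: v(x-a)>\gamma\}$ with $a\in K$, $\gamma\in\Gamma_K\cup\{-\infty\}$ (so $K$ is an open ball), closed balls are the sets $\{x: v(x-a)\ge\gamma\}$ with $a\in K$, $\gamma\in\Gamma_K\cup\{+\infty\}$; a ball is an open or a closed ball. Let $\mathrm{rv}\colon K\to \mathrm{RV}=K^\times/(1+\mathcal{M}_K)\cup\{0\}$ be the quotient map, extended by $\mathrm{rv}(0)=0$. Assume: 1. ($C$-minimality) in every $\mathcal{L}$-structure elementarily equivalent to $(K,\mathcal{L})$, every definable subset of the field is a boolean combination of balls; 2. (definable completeness) every definable family of nested balls of $K$ whose radii tend to $+\infty$ has non-empty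 intersection; 3. every definable function $g\colon\Gamma_K\to\Gamma_K$ is eventually $\mathbb{Q}$-linear: there are $\delta,\alpha\in\Gamma_K$ and $r\in\mathbb{Q}$ with $g(\gamma)=r\gamma+\alpha$ for all $\gamma>\delta$. Let $W\subseteq K^n$ be definable, let $X\subseteq W\times K$ be a definable set projecting onto $W$, with fibres $X_w=\{x:(w,x)\in X\}$, and let $f\colon X\to K$ be a definable function such that for every $w\in W$ the function $f_w=f(w,\cdot)\colon X_w\to K$ is a local $C$-isomorphism: every $x\in X_w$ lies in an open ball $B\subseteq X_w$ such that $f_w(B)$ is an open ball and, for all $x_1,x_2,x_3\in B$, $C(x_1,x_2,x_3)\Leftrightarrow C(f_w(x_1),f_w(x_2),f_w(x_3))$, where $C(x,y,z)$ means $v(x-y)=v(x-z)<v(y-z)$. Then there is a definable set $F\subseteq X$ such that for every $w\in W$ the fibre $F_w$ is finite and $f_w|(X_w\setminus F_w)$ has locally the Jacobian property, that is, every $x\in X_w\setminus F_w$ lies in an open ball $B\subseteq X_w\setminus F_w$ such that * (i) $f_w|B$ is injective and $f_w(B)$ is an open ball; * (ii) $f_w|B$ is differentiable (for the valuation topology)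 and its derivative $f_w'$ has no zero on $B$; * (iii) $\mathrm{rv}(f_w'(y))$ is constant on $B$, say equal to $c$; * (iv) $\mathrm{rv}(f_w(y)-f_w(z))=\mathrm{rv}(y-z)\,c$ for all $y,z\in B$. -/

import Mathlib

open FirstOrder FirstOrder.Language FirstOrder.Language.Structure

universe u₁ u₂ w w'

/-! ### The language of valued fields and its expansions -/

/-- The only relation symbol of the language of valued fields: the binary predicate `div`. -/
inductive DivRel : ℕ → Type
  | div : DivRel 2

/-- The language `(+, -, ·, 0, 1, div)` of valued fields. -/
def Ldiv : FirstOrder.Language.{0, 0} := ⟨FirstOrder.Language.ring.Functions, DivRel⟩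

namespace Ldiv

def addSymb : Ldiv.Functions 2 := ringFunc.add
def mulSymb : Ldiv.Functions 2 := ringFunc.mul
def negSymb : Ldiv.Functions 1 := ringFunc.neg
def zeroSymb : Ldiv.Functions 0 := ringFunc.zero
def oneSymb : Ldiv.Functions 0 := ringFunc.one
def divSymb : Ldiv.Relations 2 := DivRel.div

end Ldiv

section Expansion

variable {L : FirstOrder.Language.{u₁, u₂}} (φ : Ldiv →ᴸ L)

/-- The `L`-structure on the field `K` expands the valued field `(K, v)`: along `φ : Ldiv →ᴸ L` the
symbols of the language of valued fields have their usual meaning, `div (x, y)` being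
`v x ≤ v y`. -/
structure ExpandsValuedField {K : Type w} [Field K] {Γ : Type w'} [AddCommGroup Γ] [LinearOrder Γ]
    [IsOrderedAddMonoid Γ] (v : AddValuation K (WithTop Γ)) [L.Structure K] : Prop where
  map_add : ∀ x y : K, funMap (φ.onFunction Ldiv.addSymb) ![x, y] = x + y
  map_mul : ∀ x y : K, funMap (φ.onFunction Ldiv.mulSymb) ![x, y] = x * y
  map_neg : ∀ x : K, funMap (φ.onFunction Ldiv.negSymb) ![x] = -x
  map_zero : funMap (φ.onFunction Ldiv.zeroSymb) ![] = (0 : K)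
  map_one : funMap (φ.onFunction Ldiv.oneSymb) ![] = (1 : K)
  map_div : ∀ x y : K, RelMap (φ.onRelation Ldiv.divSymb) ![x, y] ↔ v x ≤ v y

variable (M : Type w) [L.Structure M]

/-- The difference `x - y`, computed with the symbols of the language. -/
def symbSub (x y : M) : M :=
  funMap (φ.onFunction Ldiv.addSymb) ![x, funMap (φ.onFunction Ldiv.negSymb) ![y] ]

/-- The relation `v x ≤ v y`, read from the symbol `div`. -/
def symbDiv (x y : M) : Prop :=
  RelMap (φ.onRelation Ldiv.divSymb) ![x, y]

/-- The balls of the valued field underlying an `L`-structure `M` (a structure elementarily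
equivalent to an expansion of a valued field), a radius being given as the value of some `c`:
the whole field, `{x | v c ≤ v (x - a)}` (a point if `c = 0`), and `{x | v c < v (x - a)}`
(empty if `c = 0`). -/
def symbBalls : Set (Set M) :=
  {S | S = Set.univ ∨ (∃ a c : M, S = {x | symbDiv φ M c (symbSub φ M x a)}) ∨
    ∃ a c : M, S = {x | ¬ symbDiv φ M (symbSub φ M x a) c}}

/-- `C`-minimality: in every structure elementarily equivalent to `M`, each subset definable with
parameters is a boolean combination of balls. -/
def IsCMinimal : Prop :=
  ∀ (N : Type w) [L.Structure N], M ≅[L] N →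
    ∀ S : Set N, (Set.univ : Set N).Definable₁ L S →
      S ∈ BooleanSubalgebra.closure (symbBalls φ N)

end Expansion

/-! ### Definable families, with parameters allowed everywhere -/

section Families

variable (L : FirstOrder.Language.{u₁, u₂}) {K : Type w} [L.Structure K] {n : ℕ}

/-- Definability of a subset of `Kⁿ × K`. -/
def DefinableProd (X : Set ((Fin n → K) × K)) : Prop :=
  (Set.univ : Set K).Definable L
    {q : Fin n ⊕ Fin 1 → K | ((fun i => q (Sum.inl i)), q (Sum.inr 0)) ∈ X}

/-- The fibre `X_w`. -/
def fiber (X : Set ((Fin n → K) × K)) (w : Fin n → K) : Set K := {x | (w, x) ∈ X}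

/-- `X ⊆ W × K` is a definable family of subsets of `K` parametrized by the definable set `W`. -/
structure IsDefinableFamily (W : Set (Fin n → K)) (X : Set ((Fin n → K) × K)) : Prop where
  base : (Set.univ : Set K).Definable L W
  total : DefinableProd L X
  proj : Prod.fst '' X = W

/-- `(w, x) ↦ f w x`, restricted to `X ⊆ Kⁿ × K`, is a definable function, that is, its graph is
definable; the values of `f` off `X` play no role. -/
def IsDefinableFunOn (X : Set ((Fin n → K) × K)) (f : (Fin n → K) → K → K) : Prop :=
  (Set.univ : Set K).Definable L
    {q : Fin n ⊕ Fin 2 → K | ((fun i => q (Sum.inl i)), q (Sum.inr 0)) ∈ X ∧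
      q (Sum.inr 1) = f (fun i => q (Sum.inl i)) (q (Sum.inr 0))}

end Families

/-! ### Balls, `C`-isomorphisms, `RV` and the Jacobian property -/

section ValuedField

variable {K : Type w} [Field K] {Γ : Type w'} [AddCommGroup Γ] [LinearOrder Γ]
  [IsOrderedAddMonoid Γ] (v : AddValuation K (WithTop Γ))

/-- The closed ball `{x | v (x - a) ≥ γ}`, with `γ ∈ Γ ∪ {+∞}`. -/
def closedBall (a : K) (γ : WithTop Γ) : Set K := {x | γ ≤ v (x - a)}

/-- The open ball `{x | v (x - a) > γ}`, with `γ ∈ Γ ∪ {-∞}`; for `γ = -∞` it is `K`. -/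
def openBall (a : K) (γ : WithBot Γ) : Set K :=
  {x | WithBot.map (fun g : Γ => (g : WithTop Γ)) γ < ((v (x - a) : WithTop Γ) : WithBot (WithTop Γ))}

def IsOpenBall (B : Set K) : Prop := ∃ (a : K) (γ : WithBot Γ), B = openBall v a γ

def IsBall (B : Set K) : Prop := (∃ (a : K) (γ : WithTop Γ), B = closedBall v a γ) ∨ IsOpenBall v B

/-- `B` is a ball, open or closed, with a radius greater than `γ`. -/
def IsBallOfRadiusGT (γ : Γ) (B : Set K) : Prop :=
  (∃ (a : K) (ρ : WithTop Γ), (γ : WithTop Γ) < ρ ∧ B = closedBall v a ρ) ∨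
    ∃ (a : K) (ρ : WithBot Γ), (γ : WithBot Γ) < ρ ∧ B = openBall v a ρ

/-- Every definable family of nested balls whose radii tend to `+∞` has a common point. -/
def IsDefinablyComplete (L : FirstOrder.Language.{u₁, u₂}) [L.Structure K] : Prop :=
  ∀ (n : ℕ) (W : Set (Fin n → K)) (X : Set ((Fin n → K) × K)), IsDefinableFamily L W X →
    (∀ w ∈ W, IsBall v (fiber X w)) →
    (∀ w ∈ W, ∀ w' ∈ W, fiber X w ⊆ fiber X w' ∨ fiber X w' ⊆ fiber X w) →
    (∀ γ : Γ, ∃ w ∈ W, IsBallOfRadiusGT v γ (fiber X w)) →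
    (⋂ w ∈ W, fiber X w).Nonempty

/-- Definability of a function on the value group: its graph, pulled back to `K × K` along the
valuation, is definable. -/
def IsDefinableGammaFun (L : FirstOrder.Language.{u₁, u₂}) [L.Structure K] (g : Γ → Γ) : Prop :=
  (Set.univ : Set K).Definable₂ L
    {p : K × K | ∃ γ : Γ, v p.1 = (γ : WithTop Γ) ∧ v p.2 = (g γ : WithTop Γ)}

/-- `g γ = r γ + α` for all large `γ`, where `r` is a rational number; the equation is multiplied
by the denominator of `r`. -/
def EventuallyQLinear (g : Γ → Γ) : Prop :=
  ∃ (δ α : Γ) (r : ℚ), ∀ γ : Γ, δ < γ → r.den • (g γ - α) = r.num • γ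

/-- The `C`-relation. -/
def CRel (x y z : K) : Prop := v (x - y) = v (x - z) ∧ v (x - z) < v (y - z)

/-- `f` restricted to the open ball `B` is a `C`-isomorphism. -/
def IsCIsoOn (f : K → K) (B : Set K) : Prop :=
  IsOpenBall v (f '' B) ∧
    ∀ x ∈ B, ∀ y ∈ B, ∀ z ∈ B, CRel v x y z ↔ CRel v (f x) (f y) (f z)

/-- `f` restricted to `X` is a local `C`-isomorphism. -/
def IsLocalCIsoOn (f : K → K) (X : Set K) : Prop :=
  ∀ x ∈ X, ∃ B : Set K, IsOpenBall v B ∧ x ∈ B ∧ B ⊆ X ∧ IsCIsoOn v f B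

/-- The subgroup `1 + 𝓜` of `Kˣ`. -/
def oneAddMax : Subgroup Kˣ where
  carrier := {a | 0 < v ((a : K) - 1)}
  one_mem' := by simp
  mul_mem' := by
    intro a b ha hb
    have e : ((a * b : Kˣ) : K) - 1 = (a - 1) * (b - 1) + ((a - 1) + (b - 1)) := by
      push_cast; ring
    simp only [Set.mem_ofPred_eq] at ha hb ⊢
    rw [e]
    refine lt_of_lt_of_le (lt_min ?_ (lt_min ha hb)) ((le_min (min_le_left _ _)
      ((min_le_right _ _).trans (v.map_add _ _))).trans (v.map_add _ _))
    rw [v.map_mul]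
    exact lt_of_lt_of_le ha (le_add_of_nonneg_right hb.le)
  inv_mem' := by
    intro a ha
    simp only [Set.mem_ofPred_eq] at ha ⊢
    have h1 : v (a : K) = 0 := by
      have e : (a : K) = 1 + (a - 1) := by ring
      rw [e, ← v.map_one]
      exact v.map_add_eq_of_lt_left (by rwa [v.map_one])
    have h2 : v ((a⁻¹ : Kˣ) : K) = 0 := by
      have := v.map_mul (a : K) ((a⁻¹ : Kˣ) : K)
      rw [Units.mul_inv, v.map_one, h1, zero_add] at this
      exact this.symm
    have e : ((a⁻¹ : Kˣ) : K) - 1 = ((a⁻¹ : Kˣ) : K) * (-(a - 1)) := by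
      rw [neg_sub, mul_sub, mul_one, Units.inv_mul]
    rw [e, v.map_mul, h2, zero_add, v.map_neg]
    exact ha

/-- The group `Kˣ / (1 + 𝓜)`. -/
def RVUnits : Type w := Kˣ ⧸ oneAddMax v

instance : CommGroup (RVUnits v) := inferInstanceAs (CommGroup (Kˣ ⧸ oneAddMax v))

/-- `RV = Kˣ / (1 + 𝓜) ∪ {0}`. -/
abbrev RV : Type w := WithZero (RVUnits v)

/-- The quotient map `Kˣ → Kˣ / (1 + 𝓜)`. -/
def rvUnit : Kˣ →* RVUnits v := QuotientGroup.mk' (oneAddMax v)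

open Classical in
/-- The map `rv : K → RV`. -/
noncomputable def rv (x : K) : RV v :=
  if h : x = 0 then 0 else (rvUnit v (Units.mk0 x h) : RV v)

/-- `d` is the derivative at `x`, for the valuation topology, of `f` restricted to `B`. -/
def HasValDerivOn (f : K → K) (B : Set K) (x d : K) : Prop :=
  ∀ γ : Γ, ∃ δ : Γ, ∀ y ∈ B, y ≠ x → (δ : WithTop Γ) < v (y - x) →
    (γ : WithTop Γ) < v ((f y - f x) / (y - x) - d)

/-- `f` restricted to the open ball `B` has the Jacobian property. -/
def HasJacobianProperty (f : K → K) (B : Set K) : Prop :=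
  Set.InjOn f B ∧ IsOpenBall v (f '' B) ∧
    ∃ f' : K → K, (∀ x ∈ B, HasValDerivOn v f B x (f' x) ∧ f' x ≠ 0) ∧
      ∃ c : RV v, (∀ x ∈ B, rv v (f' x) = c) ∧
        ∀ x ∈ B, ∀ y ∈ B, rv v (f x - f y) = rv v (x - y) * c

/-- `f` restricted to `X` has locally the Jacobian property. -/
def HasLocallyJacobianProperty (f : K → K) (X : Set K) : Prop :=
  ∀ x ∈ X, ∃ B : Set K, IsOpenBall v B ∧ x ∈ B ∧ B ⊆ X ∧ HasJacobianProperty v f B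

end ValuedField

/-!
By `C`-minimality a definable set that contains no open ball is finite, so it suffices to find, in
each ball on which `f` is a definable `C`-isomorphism, a smaller one on which all difference
quotients of `f` lie in a single residue class `d (1 + 𝓜)`. Near such points the Jacobian property
holds with `c = rv d`, definable completeness providing the derivative as a limit of the quotients.

`C`-minimality also decides every definable property of `s` as `s` tends to `0`, and of the generic
point of a closed ball; compactness makes this uniform in families.

A `C`-isomorphism distorts distances, on a suitable ball, by a strictly monotone function of the
distance, which is eventually `ℚ`-linear: `v (f y - f z) = α + (m / n) v (y - z)`. The definable map
`s ↦ (f (a + s) - f a) ^ n / s ^ m` then has constant value, and such a map settles in one residue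
class as `s` tends to `0`. Comparing it at `τ s` and `s`, with `τ` close to `1`, forces `m = n`. So
the difference quotients have constant value. At each point they settle in a residue class, and
since a definable map from a ball to the residue field is constant on a smaller ball, this class is
the same at all points of such a ball.
-/

/-- A type identified with a finite power of `K`, so that definability of subsets of powers of `K`
makes sense for it. -/
class FinitePower (K : Type w) (α : Type w) where
  /-- The index type of the power. -/
  Ix : Type
  finite : Finite Ix
  /-- The coordinates. -/
  equiv : α ≃ (Ix → K)

attribute [instance] FinitePower.finite

instance FinitePower.pi (K : Type w) (n : ℕ) : FinitePower K (Fin n → K) :=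
  ⟨Fin n, inferInstance, Equiv.refl _⟩

instance FinitePower.self (K : Type w) : FinitePower K K :=
  ⟨Unit, inferInstance, (Equiv.funUnique Unit K).symm⟩

instance FinitePower.prod (K : Type w) (α β : Type w) [FinitePower K α] [FinitePower K β] :
    FinitePower K (α × β) :=
  ⟨Ix K α ⊕ Ix K β, inferInstance,
    (Equiv.prodCongr equiv equiv).trans (Equiv.sumArrowEquivProdArrow _ _ _).symm⟩

section Definability

variable (L : FirstOrder.Language.{u₁, u₂}) (K : Type w) [L.Structure K]

/-- Definability, with parameters, of a predicate on a finite power of `K`. -/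
def DefPred {α : Type w} [FinitePower K α] (P : α → Prop) : Prop :=
  (Set.univ : Set K).Definable L {x : FinitePower.Ix K α → K | P (FinitePower.equiv.symm x)}

/-- Definability, with parameters, of a map between finite powers of `K`. -/
@[fun_prop]
def DefMap {α β : Type w} [FinitePower K α] [FinitePower K β] (t : α → β) : Prop :=
  (Set.univ : Set K).DefinableMap L
    (fun x : FinitePower.Ix K α → K => FinitePower.equiv (K := K) (t (FinitePower.equiv.symm x)))

variable {L K} {α β γ : Type w} [FinitePower K α] [FinitePower K β] [FinitePower K γ]

namespace DefMap

@[fun_prop]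
theorem id : DefMap L K fun a : α => a := by
  intro i
  simpa using Set.DefinableFun.proj L

@[fun_prop]
theorem const (c : β) : DefMap L K fun _ : α => c := fun i =>
  L.definableFun_const (FinitePower.Ix K α) (Set.mem_univ (FinitePower.equiv (K := K) c i))

@[fun_prop]
theorem comp {s : β → γ} (hs : DefMap L K s) {t : α → β} (ht : DefMap L K t) :
    DefMap L K fun a => s (t a) := by
  intro i
  simpa using Set.DefinableFun.comp ht (hs i)

@[fun_prop]
theorem prodMk {s : α → β} {t : α → γ} (hs : DefMap L K s) (ht : DefMap L K t) :
    DefMap L K fun a => (s a, t a) := by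
  rintro (i | i)
  · exact hs i
  · exact ht i

@[fun_prop]
theorem fst {t : α → β × γ} (ht : DefMap L K t) : DefMap L K fun a => (t a).1 :=
  fun i => ht (Sum.inl i)

@[fun_prop]
theorem snd {t : α → β × γ} (ht : DefMap L K t) : DefMap L K fun a => (t a).2 :=
  fun i => ht (Sum.inr i)

@[fun_prop]
theorem apply {n : ℕ} (i : Fin n) : DefMap L K fun y : Fin n → K => y i := fun _ =>
  Set.DefinableFun.proj L

theorem of_graph {t : α → K} (h : DefPred L K fun p : α × K => p.2 = t p.1) : DefMap L K t := by
  intro i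
  unfold Set.DefinableFun
  convert! Set.Definable.preimage_comp
    (fun j : FinitePower.Ix K α ⊕ Unit => Sum.elim some (fun _ => none) j) h using 1
  ext x
  exact eq_comm

theorem eq {s t : α → K} (hs : DefMap L K s := by fun_prop) (ht : DefMap L K t := by fun_prop) :
    DefPred L K fun a => s a = t a :=
  Set.DefinableFun.ofPred_eq (hs ()) (ht ())

theorem definableMap_vec₂ {s t : α → K} (hs : DefMap L K s) (ht : DefMap L K t) :
    (Set.univ : Set K).DefinableMap L fun x : FinitePower.Ix K α → K =>
      ![s (FinitePower.equiv.symm x), t (FinitePower.equiv.symm x)] := by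
  intro j
  fin_cases j
  exacts [hs (), ht ()]

theorem funMap₂ (g : L.Functions 2) {s t : α → K} (hs : DefMap L K s) (ht : DefMap L K t) :
    DefMap L K fun a => funMap g ![s a, t a] := fun _ =>
  Set.DefinableFun.comp (hs.definableMap_vec₂ ht)
    (Set.DefinableFun.of_empty (Set.DefinableFun.fun_symbol g))

end DefMap

namespace DefPred

variable {P Q : α → Prop}

theorem comp {P : β → Prop} (hP : DefPred L K P) {t : α → β}
    (ht : DefMap L K t := by fun_prop) :
    DefPred L K fun a => P (t a) := by
  unfold DefPred
  convert! Set.Definable.preimage_map ht hP using 1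
  ext x
  simp

theorem comp₂ {R : β → γ → Prop} (hR : DefPred L K fun p : β × γ => R p.1 p.2) {s : α → β}
    {t : α → γ} (hs : DefMap L K s := by fun_prop) (ht : DefMap L K t := by fun_prop) :
    DefPred L K fun a => R (s a) (t a) :=
  hR.comp (hs.prodMk ht)

theorem not (hP : DefPred L K P) : DefPred L K fun a => ¬ P a :=
  Set.Definable.compl hP

theorem and (hP : DefPred L K P) (hQ : DefPred L K Q) : DefPred L K fun a => P a ∧ Q a :=
  Set.Definable.inter hP hQ

theorem or (hP : DefPred L K P) (hQ : DefPred L K Q) : DefPred L K fun a => P a ∨ Q a :=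
  Set.Definable.union hP hQ

theorem imp (hP : DefPred L K P) (hQ : DefPred L K Q) : DefPred L K fun a => P a → Q a := by
  simpa only [imp_iff_not_or] using hP.not.or hQ

theorem forall_finite {ι : Sort*} [Finite ι] {P : ι → α → Prop} (hP : ∀ i, DefPred L K (P i)) :
    DefPred L K fun a => ∀ i, P i a := by
  cases nonempty_fintype (PLift ι)
  unfold DefPred
  convert! Set.definable_biInter_finset (fun i : PLift ι => hP i.down) Finset.univ using 1
  ext x
  simp [PLift.forall]

theorem ex {P : α → β → Prop} (hP : DefPred L K fun p : α × β => P p.1 p.2) :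
    DefPred L K fun a => ∃ y, P a y := by
  unfold DefPred at hP ⊢
  convert! Set.Definable.exists_of_finite hP using 1
  ext x
  simp only [Set.mem_ofPred_eq]
  rw [← (FinitePower.equiv (K := K) (α := β)).symm.exists_congr_right]
  rfl

theorem all {P : α → β → Prop} (hP : DefPred L K fun p : α × β => P p.1 p.2) :
    DefPred L K fun a => ∀ y, P a y := by
  simpa only [not_exists, not_not] using (DefPred.ex (P := fun a y => ¬ P a y) hP.not).not

theorem relMap₂ (r : L.Relations 2) {s t : α → K} (hs : DefMap L K s) (ht : DefMap L K t) :
    DefPred L K fun a => RelMap r ![s a, t a] := by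
  have hr : (Set.univ : Set K).Definable L {x : Fin 2 → K | RelMap r x} := by
    refine Set.Definable.mono ?_ (Set.empty_subset _)
    rw [Set.empty_definable_iff]
    refine ⟨r.formula Term.var, ?_⟩
    ext x
    simp [Formula.realize_rel]
  exact Set.Definable.preimage_map (hs.definableMap_vec₂ ht) hr

end DefPred

theorem definableProd_iff_defPred {n : ℕ} {X : Set ((Fin n → K) × K)} :
    DefinableProd L X ↔ DefPred L K fun p : (Fin n → K) × K => p ∈ X :=
  ⟨fun h => Set.Definable.preimage_comp (Sum.map id fun _ : Fin 1 => ()) h,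
    fun h => Set.Definable.preimage_comp (Sum.map id fun _ : Unit => (0 : Fin 1)) h⟩

end Definability

section DefinableField

/-- The field operations of `K` are definable. -/
class DefinableField (L : FirstOrder.Language.{u₁, u₂}) (K : Type w) [Field K] [L.Structure K] :
    Prop where
  add : DefMap L K fun p : K × K => p.1 + p.2
  mul : DefMap L K fun p : K × K => p.1 * p.2

variable {L : FirstOrder.Language.{u₁, u₂}} {K : Type w} [Field K] [L.Structure K]
  [DefinableField L K] {α : Type w} [FinitePower K α] {s t : α → K}

namespace DefMap

@[fun_prop]
theorem add (hs : DefMap L K s) (ht : DefMap L K t) : DefMap L K fun a => s a + t a :=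
  DefinableField.add.comp (hs.prodMk ht)

@[fun_prop]
theorem mul (hs : DefMap L K s) (ht : DefMap L K t) : DefMap L K fun a => s a * t a :=
  DefinableField.mul.comp (hs.prodMk ht)

@[fun_prop]
theorem sub (hs : DefMap L K s) (ht : DefMap L K t) : DefMap L K fun a => s a - t a :=
  of_graph <| by
    simp only [eq_sub_iff_add_eq]
    exact DefMap.eq

@[fun_prop]
theorem pow (ht : DefMap L K t) (n : ℕ) : DefMap L K fun a => t a ^ n := by
  induction n with
  | zero => simpa only [pow_zero] using DefMap.const (1 : K)
  | succ n ih => simpa only [pow_succ] using ih.mul ht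

@[fun_prop]
theorem div (hs : DefMap L K s) (ht : DefMap L K t) : DefMap L K fun a => s a / t a := by
  refine of_graph ?_
  have graph (p : α × K) : p.2 = s p.1 / t p.1 ↔
      (t p.1 ≠ 0 ∧ p.2 * t p.1 = s p.1) ∨ (t p.1 = 0 ∧ p.2 = 0) := by
    by_cases h : t p.1 = 0 <;> simp [h, eq_div_iff]
  simp only [graph]
  have hzero : DefPred L K fun p : α × K => t p.1 = 0 := DefMap.eq
  exact (hzero.not.and (DefMap.eq)).or
    (hzero.and (DefMap.eq))

end DefMap

end DefinableField

section DefinableValuation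

/-- The relation `v x ≤ v y` is definable. -/
class DefinableValuation (L : FirstOrder.Language.{u₁, u₂}) {K : Type w} [Field K] {Γ : Type w'}
    [AddCommGroup Γ] [LinearOrder Γ] [IsOrderedAddMonoid Γ] (v : AddValuation K (WithTop Γ))
    [L.Structure K] : Prop where
  le : DefPred L K fun p : K × K => v p.1 ≤ v p.2

variable (L : FirstOrder.Language.{u₁, u₂}) {K : Type w} [Field K] {Γ : Type w'}
  [AddCommGroup Γ] [LinearOrder Γ] [IsOrderedAddMonoid Γ] (v : AddValuation K (WithTop Γ))
  [L.Structure K] {α β : Type w} [FinitePower K α] [FinitePower K β]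

/-- Definability of a map from a finite power of `K` to `Γ ∪ {∞}`, by pulling its hypograph back
along the valuation. -/
@[fun_prop]
def DefVal (H : α → WithTop Γ) : Prop := DefPred L K fun p : α × K => v p.2 ≤ H p.1

variable {L v}

namespace DefVal

variable {H H' : α → WithTop Γ}

@[fun_prop]
theorem comp {H : β → WithTop Γ} (hH : DefVal L v H) {t : α → β} (ht : DefMap L K t) :
    DefVal L v fun a => H (t a) :=
  DefPred.comp₂ (R := fun b z => v z ≤ H b) hH

@[fun_prop]
theorem valuation [DefinableValuation L v] {t : α → K} (ht : DefMap L K t) :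
    DefVal L v fun a => v (t a) :=
  DefPred.comp₂ (R := fun x y => v x ≤ v y) DefinableValuation.le

variable [Fact (Function.Surjective v)]

@[fun_prop]
theorem const [DefinableValuation L v] (γ : WithTop Γ) : DefVal L v fun _ : α => γ := by
  obtain ⟨c, rfl⟩ := (Fact.out : Function.Surjective v) γ
  exact valuation (.const c)

variable (v) in
theorem le (h : DefVal L v H := by fun_prop) (h' : DefVal L v H' := by fun_prop) :
    DefPred L K fun a => H a ≤ H' a := by
  have hle (a : α) : H a ≤ H' a ↔ ∀ z, v z ≤ H a → v z ≤ H' a :=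
    forall_le_iff_le.symm.trans (Fact.out : Function.Surjective v).forall
  simpa only [hle] using DefPred.all (P := fun a z => v z ≤ H a → v z ≤ H' a) (DefPred.imp h h')

variable (v) in
theorem lt (h : DefVal L v H := by fun_prop) (h' : DefVal L v H' := by fun_prop) :
    DefPred L K fun a => H a < H' a := by
  simpa only [not_le] using (DefVal.le v h' h).not

variable (v) in
theorem eq (h : DefVal L v H := by fun_prop) (h' : DefVal L v H' := by fun_prop) :
    DefPred L K fun a => H a = H' a := by
  simpa only [le_antisymm_iff] using (DefVal.le v h h').and (DefVal.le v h' h)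

end DefVal

end DefinableValuation

namespace ExpandsValuedField

variable {L : FirstOrder.Language.{u₁, u₂}} {φ : Ldiv →ᴸ L} {K : Type w} [Field K]
  [L.Structure K] {Γ : Type w'} [AddCommGroup Γ] [LinearOrder Γ] [IsOrderedAddMonoid Γ]
  {v : AddValuation K (WithTop Γ)} (h : ExpandsValuedField φ v)
include h

theorem definableField : DefinableField L K where
  add := by
    simpa only [h.map_add] using DefMap.funMap₂ (φ.onFunction Ldiv.addSymb)
      (s := fun p : K × K => p.1) (t := fun p => p.2) (by fun_prop) (by fun_prop)
  mul := by
    simpa only [h.map_mul] using DefMap.funMap₂ (φ.onFunction Ldiv.mulSymb)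
      (s := fun p : K × K => p.1) (t := fun p => p.2) (by fun_prop) (by fun_prop)

theorem definableValuation : DefinableValuation L v where
  le := by
    simpa only [h.map_div] using DefPred.relMap₂ (φ.onRelation Ldiv.divSymb)
      (s := fun p : K × K => p.1) (t := fun p => p.2) (by fun_prop) (by fun_prop)

end ExpandsValuedField

/-- `A` is a Boolean combination of the balls `{t | v c ≤ v (t - a)}` and `{t | v c < v (t - a)}`
with `(a, c) ∈ P`: the position of `t` with respect to these balls decides whether `A t` holds. -/
def IsCutBy {K : Type w} [Field K] {Γ : Type w'} [AddCommGroup Γ] [LinearOrder Γ]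
    [IsOrderedAddMonoid Γ] (v : AddValuation K (WithTop Γ)) (P : Finset (K × K)) (A : K → Prop) :
    Prop :=
  ∀ t t' : K, (∀ p ∈ P, cmp (v p.2) (v (t - p.1)) = cmp (v p.2) (v (t' - p.1))) → (A t ↔ A t')

/-- Each definable family of subsets of `K` consists of Boolean combinations of a bounded number of
balls. -/
class UniformlyCMinimal (L : FirstOrder.Language.{u₁, u₂}) {K : Type w} [Field K] {Γ : Type w'}
    [AddCommGroup Γ] [LinearOrder Γ] [IsOrderedAddMonoid Γ] (v : AddValuation K (WithTop Γ))
    [L.Structure K] : Prop where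
  exists_cut : ∀ {α : Type w} [FinitePower K α] {R : α → K → Prop},
    DefPred L K (fun p : α × K => R p.1 p.2) →
      ∃ N : ℕ, ∀ a, ∃ P : Finset (K × K), P.card ≤ N ∧ IsCutBy v P (R a)

section Ultrapower

open Filter

/-- The ultrapower of `K` along `U`, an `L`-structure elementarily equivalent to `K` in which
sequences of members of a definable family become single definable sets. -/
abbrev Ultrapower {I : Type} (U : Ultrafilter I) (K : Type w) : Type w :=
  (U : Filter I).Product fun _ => K

namespace Ultrapower

variable {L : FirstOrder.Language.{u₁, u₂}} {K : Type w} [L.Structure K] {I : Type}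
  {U : Ultrafilter I}

/-- The class of a sequence in the ultrapower. -/
def mk (U : Ultrafilter I) (x : I → K) : Ultrapower U K := Quotient.mk _ x

theorem mk_surjective : Function.Surjective (mk U (K := K)) := Quotient.mk''_surjective

theorem elementarilyEquivalent [Nonempty K] : K ≅[L] Ultrapower U K := by
  rw [elementarilyEquivalent_iff]
  intro σ
  rw [Ultraproduct.sentence_realize]
  simp

theorem funMap_mk {n : ℕ} (g : L.Functions n) (x : Fin n → I → K) :
    funMap g (fun j => mk U (x j)) = mk U fun i => funMap g fun j => x j i :=
  Ultraproduct.funMap_cast (u := U) (M := fun _ : I => K) g x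

theorem funMap₁_mk (g : L.Functions 1) (x : I → K) :
    funMap g ![mk U x] = mk U fun i => funMap g ![x i] := by
  convert funMap_mk g ![x] using 2
  · exact funext (Fin.forall_fin_one.2 rfl)
  · exact funext fun i => congrArg (funMap g) (funext (Fin.forall_fin_one.2 rfl))

theorem funMap₂_mk (g : L.Functions 2) (x y : I → K) :
    funMap g ![mk U x, mk U y] = mk U fun i => funMap g ![x i, y i] := by
  convert funMap_mk g ![x, y] using 2
  · exact funext (Fin.forall_fin_two.2 ⟨rfl, rfl⟩)
  · exact funext fun i => congrArg (funMap g) (funext (Fin.forall_fin_two.2 ⟨rfl, rfl⟩))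

theorem realize_mk {ι : Type*} [Nonempty K] (ψ : L.Formula ι) (x : ι → I → K) :
    ψ.Realize (fun j => mk U (x j)) ↔ ∀ᶠ i in U, ψ.Realize fun j => x j i :=
  Ultraproduct.realize_formula_cast (u := U) (M := fun _ : I => K) ψ x

theorem exists_definable [Nonempty K] {α : Type w} [FinitePower K α] {R : α → K → Prop}
    (hR : DefPred L K fun p : α × K => R p.1 p.2) (a : I → α) :
    ∃ S : Set (Ultrapower U K), (Set.univ : Set (Ultrapower U K)).Definable₁ L S ∧
      ∀ t : I → K, mk U t ∈ S ↔ ∀ᶠ i in U, R (a i) (t i) := by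
  obtain ⟨ψ, hψ⟩ := Set.definable_iff_exists_formula_sum.1 hR
  have realize_iff (b : α) (t : K) : R b t ↔ ψ.Realize (Sum.elim (↑)
      (Sum.elim (FinitePower.equiv b) fun _ => t) :
        (Set.univ : Set K) ⊕ (FinitePower.Ix K α ⊕ Unit) → K) := by
    have := Set.ext_iff.1 hψ (FinitePower.equiv (b, t))
    rwa [Set.mem_ofPred_eq, Equiv.symm_apply_apply] at this
  let param (t : I → K) : (Set.univ : Set K) ⊕ (FinitePower.Ix K α ⊕ Unit) → I → K :=
    Sum.elim (fun c _ => c) (Sum.elim (fun j i => FinitePower.equiv (a i) j) fun _ => t)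
  refine ⟨{s | ψ.Realize (Sum.elim (fun c => mk U fun _ => (c : K))
    (Sum.elim (fun j => mk U fun i => FinitePower.equiv (a i) j) fun _ => s))},
    Set.definable_iff_exists_formula_sum.2 ⟨ψ.relabel (Sum.elim
      (fun c : (Set.univ : Set K) => Sum.inl ⟨mk U fun _ => (c : K), Set.mem_univ _⟩)
      (Sum.elim (fun j => Sum.inl ⟨mk U fun i => FinitePower.equiv (a i) j, Set.mem_univ _⟩)
        fun _ => Sum.inr 0)), ?_⟩, fun t => ?_⟩
  · ext x
    refine Iff.trans (iff_of_eq (congrArg ψ.Realize (funext ?_))) Formula.realize_relabel.symm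
    rintro (c | j | j) <;> rfl
  · refine Iff.trans (iff_of_eq (congrArg ψ.Realize (funext ?_))) ((realize_mk ψ (param t)).trans
      (eventually_congr (Eventually.of_forall fun i => ?_)))
    · rintro (c | j | j) <;> rfl
    · rw [realize_iff]
      refine iff_of_eq (congrArg ψ.Realize (funext ?_))
      rintro (c | j | j) <;> rfl

variable [Field K] {φ : Ldiv →ᴸ L} {Γ : Type w'} [AddCommGroup Γ] [LinearOrder Γ]
  [IsOrderedAddMonoid Γ] {v : AddValuation K (WithTop Γ)} (h : ExpandsValuedField φ v)
include h

theorem symbSub_mk (x y : I → K) :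
    symbSub φ (Ultrapower U K) (mk U x) (mk U y) = mk U fun i => x i - y i := by
  have neg_mk : funMap (φ.onFunction Ldiv.negSymb) ![mk U y] = mk U fun i => -y i := by
    simp only [← h.map_neg]
    exact funMap₁_mk _ y
  have add_mk : funMap (φ.onFunction Ldiv.addSymb) ![mk U x, mk U fun i => -y i] =
      mk U fun i => x i - y i := by
    simp only [sub_eq_add_neg, ← h.map_add]
    exact funMap₂_mk _ x fun i => -y i
  rw [symbSub, neg_mk, add_mk]

theorem symbDiv_mk (x y : I → K) :
    symbDiv φ (Ultrapower U K) (mk U x) (mk U y) ↔ ∀ᶠ i in U, v (x i) ≤ v (y i) := by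
  simpa [Formula.realize_rel₂, h.map_div] using! realize_mk (U := U)
    ((φ.onRelation Ldiv.divSymb).formula₂ (Term.var (0 : Fin 2)) (Term.var 1)) ![x, y]

theorem exists_finset_of_mem_closure_symbBalls {S : Set (Ultrapower U K)}
    (hS : S ∈ BooleanSubalgebra.closure (symbBalls φ (Ultrapower U K))) :
    ∃ P : Finset ((I → K) × (I → K)), ∀ t t' : I → K,
      (∀ p ∈ P, ∀ᶠ i in U, cmp (v (p.2 i)) (v (t i - p.1 i)) = cmp (v (p.2 i)) (v (t' i - p.1 i))) →
        (mk U t ∈ S ↔ mk U t' ∈ S) := by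
  classical
  induction hS using BooleanSubalgebra.closure_bot_sup_induction with
  | mem S hS =>
    rcases hS with rfl | ⟨a, c, rfl⟩ | ⟨a, c, rfl⟩
    · exact ⟨∅, fun _ _ _ => Iff.rfl⟩
    all_goals
      obtain ⟨a, rfl⟩ := mk_surjective a
      obtain ⟨c, rfl⟩ := mk_surjective c
      refine ⟨{(a, c)}, fun t t' htt' => ?_⟩
      simp only [Finset.mem_singleton, forall_eq] at htt'
      simp only [Set.mem_ofPred_eq, symbSub_mk h, symbDiv_mk h]
    · exact eventually_congr (htt'.mono fun i hi => le_iff_le_of_cmp_eq_cmp hi)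
    · exact not_congr (eventually_congr (htt'.mono fun i hi =>
        le_iff_le_of_cmp_eq_cmp (cmp_eq_cmp_symm.1 hi)))
  | bot => exact ⟨∅, fun _ _ _ => Iff.rfl⟩
  | sup S _ S' _ ih ih' =>
    obtain ⟨P, hP⟩ := ih
    obtain ⟨P', hP'⟩ := ih'
    refine ⟨P ∪ P', fun t t' htt' => ?_⟩
    exact or_congr (hP t t' fun p hp => htt' p (Finset.mem_union_left _ hp))
      (hP' t t' fun p hp => htt' p (Finset.mem_union_right _ hp))
  | compl S _ ih =>
    obtain ⟨P, hP⟩ := ih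
    exact ⟨P, fun t t' htt' => not_congr (hP t t' htt')⟩

end Ultrapower

/-- If no finite number of balls sufficed for the whole family, the ultraproduct of members needing
more and more balls would be a definable subset of an ultrapower of `K` which is not a Boolean
combination of balls. -/
theorem IsCMinimal.uniformlyCMinimal {L : FirstOrder.Language.{u₁, u₂}} {φ : Ldiv →ᴸ L}
    {K : Type w} [Field K] [L.Structure K] {Γ : Type w'} [AddCommGroup Γ] [LinearOrder Γ]
    [IsOrderedAddMonoid Γ] {v : AddValuation K (WithTop Γ)} (hmin : IsCMinimal φ K)
    (h : ExpandsValuedField φ v) : UniformlyCMinimal L v where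
  exists_cut {α} _ R hR := by
    classical
    by_contra! hcon
    choose a ha using hcon
    let U : Ultrafilter ℕ := hyperfilter ℕ
    obtain ⟨S, hSdef, hS⟩ := Ultrapower.exists_definable (U := U) hR a
    obtain ⟨P, hP⟩ := Ultrapower.exists_finset_of_mem_closure_symbBalls h
      (hmin _ Ultrapower.elementarilyEquivalent S hSdef)
    have not_cut : ∀ᶠ n in U, ¬ IsCutBy v (P.image fun p => (p.1 n, p.2 n)) (R (a n)) := by
      have large : ∀ᶠ n in U, P.card ≤ n := (eventually_ge_atTop P.card).filter_mono
        ((hyperfilter_le_cofinite).trans Nat.cofinite_eq_atTop.le)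
      exact large.mono fun n hn => ha n _ (Finset.card_image_le.trans hn)
    have witness : ∀ᶠ n in U, ∃ t t' : K, (∀ p ∈ P,
        cmp (v (p.2 n)) (v (t - p.1 n)) = cmp (v (p.2 n)) (v (t' - p.1 n))) ∧
          ¬ (R (a n) t ↔ R (a n) t') := by
      filter_upwards [not_cut] with n hn
      simpa only [IsCutBy, Finset.forall_mem_image, not_forall, exists_prop] using hn
    obtain ⟨t, ht⟩ := witness.choice
    obtain ⟨t', ht'⟩ := ht.choice
    have same : (∀ᶠ n in U, R (a n) (t n)) ↔ ∀ᶠ n in U, R (a n) (t' n) := by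
      simpa only [hS] using hP t t' fun p hp => ht'.mono fun n hn => hn.1 p hp
    have eventually_same : ∀ᶠ n in U, (R (a n) (t n) ↔ R (a n) (t' n)) := by
      simpa only [iff_iff_implies_and_implies, eventually_and, Ultrafilter.eventually_imp]
        using same
    obtain ⟨n, hn, hn'⟩ := (eventually_same.and ht').exists
    exact hn'.2 hn

end Ultrapower

section Valuation

variable {K : Type w} [Field K] {Γ : Type w'} [AddCommGroup Γ] [LinearOrder Γ]
  [IsOrderedAddMonoid Γ] {v : AddValuation K (WithTop Γ)} {x y z : K} {γ : WithTop Γ}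

theorem le_v_sub_of_le_of_le (h : γ ≤ v (x - y)) (h' : γ ≤ v (y - z)) : γ ≤ v (x - z) := by
  simpa only [sub_add_sub_cancel] using v.map_le_add h h'

theorem lt_v_sub_of_lt_of_lt (h : γ < v (x - y)) (h' : γ < v (y - z)) : γ < v (x - z) := by
  simpa only [sub_add_sub_cancel] using v.map_lt_add h h'

theorem v_sub_eq_of_lt (h : v (x - z) < v (x - y)) : v (y - z) = v (x - z) := by
  rw [← sub_sub_sub_cancel_left z y x, v.map_sub_eq_of_lt_left h]

theorem v_sub_eq_of_le_of_le (h : v (x - z) ≤ γ) (h' : v (y - z) ≤ γ) (hxy : γ ≤ v (x - y)) :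
    v (x - z) = v (y - z) := by
  by_contra hne
  rcases lt_or_gt_of_ne hne with hlt | hlt
  · exact hne (v_sub_eq_of_lt ((hlt.trans_le h').trans_le hxy)).symm
  · exact hne (v_sub_eq_of_lt ((hlt.trans_le h).trans_le (v.map_sub_swap x y ▸ hxy)))

theorem exists_coe_eq_v (hx : x ≠ 0) : ∃ γ : Γ, v x = γ := by
  obtain ⟨γ, hγ⟩ := WithTop.ne_top_iff_exists.1 ((v.ne_top_iff).2 hx)
  exact ⟨γ, hγ.symm⟩

theorem ne_zero_of_v_eq_coe {γ : Γ} (hx : v x = γ) : x ≠ 0 :=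
  (v.ne_top_iff).1 (hx ▸ WithTop.coe_ne_top)

theorem v_prod {ι : Type*} (s : Finset ι) (g : ι → K) : v (∏ i ∈ s, g i) = ∑ i ∈ s, v (g i) := by
  classical
  induction s using Finset.induction_on with
  | empty => simp
  | insert i s hi ih => rw [Finset.prod_insert hi, Finset.sum_insert hi, v.map_mul, ih]

/-- A root `t` of `∏ q ∈ Q, (X - q) = 1` will do. -/
theorem exists_integral_residually_ne [IsAlgClosed K] (Q : Finset K) (hQ : ∀ q ∈ Q, 0 ≤ v q) :
    ∃ t : K, 0 ≤ v t ∧ ∀ q ∈ Q, v (t - q) = 0 := by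
  rcases Q.eq_empty_or_nonempty with rfl | hne
  · exact ⟨0, by simp, by simp⟩
  obtain ⟨t, ht⟩ : ∃ t : K, ∏ q ∈ Q, (t - q) = 1 := by
    let p : Polynomial K := ∏ q ∈ Q, (Polynomial.X - Polynomial.C q)
    have hp : p.degree = Q.card := by simp [p, Polynomial.degree_prod]
    have hp0 : 0 < p.degree := by rw [hp]; exact_mod_cast hne.card_pos
    have hdeg : (p - 1).degree ≠ 0 := by
      rw [Polynomial.degree_sub_eq_left_of_degree_lt (by rwa [Polynomial.degree_one])]
      exact hp0.ne'
    obtain ⟨t, ht⟩ := IsAlgClosed.exists_root _ hdeg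
    exact ⟨t, by simpa [p, Polynomial.eval_prod, sub_eq_zero] using ht⟩
  have hsum : ∑ q ∈ Q, v (t - q) = 0 := by rw [← v_prod, ht, v.map_one]
  have ht0 : 0 ≤ v t := by
    by_contra! hlt
    have heq : ∀ q ∈ Q, v (t - q) = v t := fun q hq =>
      v.map_sub_eq_of_lt_left (hlt.trans_le (hQ q hq))
    obtain ⟨γ, hγ⟩ := WithTop.ne_top_iff_exists.1 hlt.ne_top
    rw [Finset.sum_congr rfl heq, Finset.sum_const, ← hγ] at hsum
    rw [← hγ] at hlt
    exact (nsmul_neg (WithTop.coe_lt_zero.1 hlt) hne.card_pos.ne').ne (by exact_mod_cast hsum)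
  exact ⟨t, ht0,
    (Finset.sum_eq_zero_iff_of_nonneg fun q hq => v.map_le_sub ht0 (hQ q hq)).1 hsum⟩

/-- The residue field being infinite, a closed ball has infinitely many residue classes. -/
theorem exists_mem_closedBall_forall_v_sub_le [IsAlgClosed K] [Fact (Function.Surjective v)]
    (a : K) (γ : WithTop Γ) (Q : Finset K) : ∃ t ∈ closedBall v a γ, ∀ q ∈ Q, v (t - q) ≤ γ := by
  classical
  obtain rfl | hγ := eq_or_ne γ ⊤
  · exact ⟨a, by simp [closedBall], fun _ _ => le_top⟩
  obtain ⟨c, rfl⟩ := (Fact.out : Function.Surjective v) γ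
  have hc : c ≠ 0 := (v.ne_top_iff).1 hγ
  obtain ⟨t, ht, hQ⟩ := exists_integral_residually_ne (v := v)
    {q ∈ Q.image fun q => (q - a) / c | 0 ≤ v q} (by simp)
  have hfar (q : K) (hq : q ∈ Q) : v (t - (q - a) / c) ≤ 0 := by
    rcases le_or_gt 0 (v ((q - a) / c)) with h | h
    · exact (hQ _ (Finset.mem_filter.2 ⟨Finset.mem_image_of_mem _ hq, h⟩)).le
    · exact (v.map_sub_eq_of_lt_right (h.trans_le ht)).trans_le h.le
  refine ⟨a + c * t, ?_, fun q hq => ?_⟩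
  · rw [closedBall, Set.mem_ofPred_eq, add_sub_cancel_left, v.map_mul]
    exact le_add_of_nonneg_right ht
  · rw [show a + c * t - q = c * (t - (q - a) / c) by field_simp; ring, v.map_mul]
    exact add_le_of_nonpos_right (hfar q hq)

end Valuation

section Filters

open Filter

variable {K : Type w} [Field K] {Γ : Type w'} [AddCommGroup Γ] [LinearOrder Γ]
  [IsOrderedAddMonoid Γ]

/-- The punctured neighbourhoods of `0` for the valuation topology. -/
def nearZero (v : AddValuation K (WithTop Γ)) : Filter K :=
  comap v (map (↑) (atTop : Filter Γ))

/-- The filter of the generic type of the closed ball of radius `γ` around `a`: its members contain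
all but finitely many residue classes of this ball. -/
def generic (v : AddValuation K (WithTop Γ)) (a : K) (γ : WithTop Γ) : Filter K :=
  ⨅ Q : Finset K, 𝓟 {b | γ ≤ v (b - a) ∧ ∀ q ∈ Q, v (b - q) ≤ γ}

variable {v : AddValuation K (WithTop Γ)} {A : K → Prop}

theorem eventually_nearZero :
    (∀ᶠ b in nearZero v, A b) ↔ ∃ δ : Γ, ∀ b, b ≠ 0 → (δ : WithTop Γ) ≤ v b → A b := by
  simp only [nearZero, eventually_comap, eventually_map, eventually_atTop]
  refine exists_congr fun δ => ⟨fun h b hb hδ => ?_, fun h γ hγ b hb => ?_⟩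
  · obtain ⟨γ, hγ⟩ := exists_coe_eq_v (v := v) hb
    exact h γ (by rwa [hγ, WithTop.coe_le_coe] at hδ) b hγ
  · exact h b (ne_zero_of_v_eq_coe hb) (by rwa [hb, WithTop.coe_le_coe])

theorem eventually_nearZero_ne : ∀ᶠ b in nearZero v, b ≠ 0 :=
  eventually_nearZero.2 ⟨0, fun _ hb _ => hb⟩

theorem eventually_nearZero_lt [Nontrivial Γ] (γ : Γ) : ∀ᶠ b in nearZero v, γ < v b := by
  obtain ⟨δ, hδ⟩ := exists_gt γ
  exact eventually_nearZero.2 ⟨δ, fun _ _ hb => (WithTop.coe_lt_coe.2 hδ).trans_le hb⟩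

instance nearZero_neBot [Fact (Function.Surjective v)] : (nearZero v).NeBot :=
  comap_neBot_iff_frequently.2 <| by
    exact Frequently.of_forall fun γ => (Fact.out : Function.Surjective v) γ

theorem tendsto_mul_nearZero {τ : K} (hτ : τ ≠ 0) :
    Tendsto (τ * ·) (nearZero v) (nearZero v) := by
  intro A hA
  obtain ⟨δ, hδ⟩ := eventually_nearZero.1 hA
  obtain ⟨ε, hε⟩ := exists_coe_eq_v (v := v) hτ
  refine eventually_nearZero.2 ⟨δ - ε, fun b hb hle => hδ _ (mul_ne_zero hτ hb) ?_⟩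
  obtain ⟨β, hβ⟩ := exists_coe_eq_v (v := v) hb
  rw [hβ, WithTop.coe_le_coe, sub_le_iff_le_add'] at hle
  rw [v.map_mul, hε, hβ]
  exact_mod_cast hle

theorem eventually_generic {a : K} {γ : WithTop Γ} :
    (∀ᶠ b in generic v a γ, A b) ↔
      ∃ Q : Finset K, ∀ b, γ ≤ v (b - a) → (∀ q ∈ Q, v (b - q) ≤ γ) → A b := by
  classical
  refine (mem_iInf_of_directed (fun Q Q' => ⟨Q ∪ Q', ?_, ?_⟩) _).trans ?_
  · exact principal_mono.2 fun b hb => ⟨hb.1, fun q hq => hb.2 q (Finset.mem_union_left _ hq)⟩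
  · exact principal_mono.2 fun b hb => ⟨hb.1, fun q hq => hb.2 q (Finset.mem_union_right _ hq)⟩
  · simp only [mem_principal, Set.subset_def, Set.mem_ofPred_eq, and_imp]

theorem eventually_generic_mem {a : K} {γ : WithTop Γ} : ∀ᶠ b in generic v a γ, γ ≤ v (b - a) :=
  eventually_generic.2 ⟨∅, fun _ hb _ => hb⟩

theorem eventually_generic_v_sub_le {a : K} {γ : WithTop Γ} (q : K) :
    ∀ᶠ b in generic v a γ, v (b - q) ≤ γ :=
  eventually_generic.2 ⟨{q}, fun _ _ hb => hb q (Finset.mem_singleton_self q)⟩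

instance generic_neBot [IsAlgClosed K] [Fact (Function.Surjective v)] {a : K} {γ : WithTop Γ} :
    (generic v a γ).NeBot := by
  refine ⟨fun hbot => ?_⟩
  obtain ⟨Q, hQ⟩ := eventually_generic.1 (show ∀ᶠ _ in generic v a γ, False by simp [hbot])
  obtain ⟨t, ht, htQ⟩ := exists_mem_closedBall_forall_v_sub_le (v := v) a γ Q
  exact hQ t ht htQ

theorem exists_forall_v_sub_le {ι κ : Type*} [Fintype ι] {γ : WithTop Γ} {y : ι → K}
    (hy : Pairwise fun i j => v (y i - y j) ≤ γ) (p : κ → K) (P : Finset κ)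
    (hP : P.card < Fintype.card ι) : ∃ i, ∀ k ∈ P, v (y i - p k) ≤ γ := by
  by_contra! hcon
  choose k hk hlt using hcon
  obtain ⟨i, -, j, -, hij, he⟩ := Finset.exists_ne_map_eq_of_card_lt_of_maps_to
    (s := Finset.univ) hP fun i _ => hk i
  have hj := hlt j
  rw [← he, v.map_sub_swap] at hj
  exact (hy hij).not_gt (lt_v_sub_of_lt_of_lt (hlt i) hj)

/-- Points chosen one after the other, each generic over the preceding ones. -/
theorem exists_seq_pairwise_of_eventually {α : Type*} {F : Filter α} [F.NeBot] {A : α → Prop}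
    {r : α → α → Prop} [Std.Symm r] (hA : ∀ᶠ a in F, A a) (hr : ∀ a, A a → ∀ᶠ b in F, r a b) :
    ∃ y : ℕ → α, (∀ n, A (y n)) ∧ Pairwise fun i j => r (y i) (y j) :=
  exists_seq_of_forall_finset_exists' A r fun s hs =>
    (hA.and ((Finset.eventually_all s).2 fun x hx => hr x (hs x hx))).exists

theorem exists_seq_of_eventually_generic [IsAlgClosed K] [Fact (Function.Surjective v)] {a : K}
    {γ : WithTop Γ} (hA : ∀ᶠ b in generic v a γ, A b) :
    ∃ y : ℕ → K, (∀ n, A (y n) ∧ γ ≤ v (y n - a)) ∧ Pairwise fun i j => v (y i - y j) ≤ γ := by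
  have : Std.Symm fun x y : K => v (x - y) ≤ γ := ⟨fun x y h => by rwa [v.map_sub_swap]⟩
  refine exists_seq_pairwise_of_eventually (r := fun x y => v (x - y) ≤ γ)
    (hA.and eventually_generic_mem) fun x _ => ?_
  filter_upwards [eventually_generic_v_sub_le x] with b hb
  rwa [v.map_sub_swap]

end Filters

section OpenBalls

variable {K : Type w} [Field K] {Γ : Type w'} [AddCommGroup Γ] [LinearOrder Γ]
  [IsOrderedAddMonoid Γ] {v : AddValuation K (WithTop Γ)} {a b x y : K} {γ δ : Γ}

theorem mem_openBall_coe : x ∈ openBall v a (γ : WithBot Γ) ↔ γ < v (x - a) := by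
  rw [openBall, Set.mem_ofPred_eq, WithBot.map_coe, WithBot.coe_lt_coe]

theorem mem_openBall_self : a ∈ openBall v a (γ : WithBot Γ) := by
  simp [mem_openBall_coe]

theorem lt_v_sub_of_mem_openBall (hx : x ∈ openBall v a (γ : WithBot Γ))
    (hy : y ∈ openBall v a (γ : WithBot Γ)) : γ < v (x - y) :=
  lt_v_sub_of_lt_of_lt (mem_openBall_coe.1 hx) (v.map_sub_swap y a ▸ mem_openBall_coe.1 hy)

theorem openBall_subset (hb : b ∈ openBall v a (γ : WithBot Γ)) (h : γ ≤ δ) :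
    openBall v b (δ : WithBot Γ) ⊆ openBall v a (γ : WithBot Γ) := fun _ hx =>
  mem_openBall_coe.2 <| lt_v_sub_of_lt_of_lt
    ((WithTop.coe_le_coe.2 h).trans_lt (mem_openBall_coe.1 hx)) (mem_openBall_coe.1 hb)

end OpenBalls

section Cut

open Filter

variable {K : Type w} [Field K] {Γ : Type w'} [AddCommGroup Γ] [LinearOrder Γ]
  [IsOrderedAddMonoid Γ] {v : AddValuation K (WithTop Γ)} {P : Finset (K × K)} {A : K → Prop}

namespace IsCutBy

theorem iff_of_v_sub_eq (h : IsCutBy v P A) {t t' : K}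
    (heq : ∀ p ∈ P, v (t - p.1) = v (t' - p.1)) : A t ↔ A t' :=
  h t t' fun p hp => by rw [heq p hp]

theorem iff_of_v_sub_le (h : IsCutBy v P A) {t t' : K} {γ : WithTop Γ}
    (ht : ∀ p ∈ P, v (t - p.1) ≤ γ) (ht' : ∀ p ∈ P, v (t' - p.1) ≤ γ) (htt' : γ ≤ v (t - t')) :
    A t ↔ A t' :=
  h.iff_of_v_sub_eq fun p hp => v_sub_eq_of_le_of_le (ht p hp) (ht' p hp) htt'

theorem iff_of_lt_v_sub (h : IsCutBy v P A) {t t' : K} {γ : WithTop Γ}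
    (ht : ∀ p ∈ P, v (t - p.1) ≤ γ) (htt' : γ < v (t - t')) : A t ↔ A t' :=
  h.iff_of_v_sub_eq fun p hp => (v_sub_eq_of_lt ((ht p hp).trans_lt htt')).symm

theorem exists_openBall (h : IsCutBy v P A) {x : K} (hx : ∀ p ∈ P, x ≠ p.1) :
    ∃ γ : Γ, ∀ y ∈ openBall v x (γ : WithBot Γ), A x ↔ A y := by
  obtain ⟨γ, hγ⟩ : ∃ γ : Γ, ∀ p ∈ P, v (x - p.1) ≤ γ := by
    have bounded (p : K × K) (hp : p ∈ P) : ∃ γ : Γ, v (x - p.1) = γ :=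
      exists_coe_eq_v (sub_ne_zero.2 (hx p hp))
    choose! g hg using bounded
    obtain ⟨γ, hγ⟩ := (P.image g).exists_le
    exact ⟨γ, fun p hp => by
      rw [hg p hp]; exact_mod_cast hγ _ (Finset.mem_image_of_mem g hp)⟩
  exact ⟨γ, fun y hy => h.iff_of_lt_v_sub hγ
    (by rw [v.map_sub_swap]; exact mem_openBall_coe.1 hy)⟩

theorem eventuallyConst (h : IsCutBy v P A) {F : Filter K}
    (hF : ∀ p ∈ P, EventuallyConst (fun t => cmp (v p.2) (v (t - p.1))) F) :
    EventuallyConst A F := by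
  have pos (p : K × K) (hp : p ∈ P) : ∃ o, ∀ᶠ t in F, cmp (v p.2) (v (t - p.1)) = o :=
    eventuallyConst_iff_exists_eventuallyEq.1 (hF p hp)
  choose! o ho using pos
  have cells : ∀ᶠ t in F, ∀ p ∈ P, cmp (v p.2) (v (t - p.1)) = o p :=
    (Finset.eventually_all P).2 ho
  rw [eventuallyConst_pred]
  by_cases hex : ∃ t, A t ∧ ∀ p ∈ P, cmp (v p.2) (v (t - p.1)) = o p
  · obtain ⟨t, hAt, ht⟩ := hex
    exact Or.inl (cells.mono fun s hs =>
      (h t s fun p hp => (ht p hp).trans (hs p hp).symm).1 hAt)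
  · exact Or.inr (cells.mono fun s hs hAs => hex ⟨s, hAs, hs⟩)

theorem eventually_generic_iff [IsAlgClosed K] [Fact (Function.Surjective v)] (h : IsCutBy v P A)
    {N : ℕ} (hP : P.card ≤ N) {a : K} {γ : WithTop Γ} :
    (∀ᶠ b in generic v a γ, A b) ↔ ∃ y : Fin (N + 1) → K,
      (∀ i, A (y i) ∧ γ ≤ v (y i - a)) ∧ ∀ i j, i ≠ j → v (y i - y j) ≤ γ := by
  refine ⟨fun hA => ?_, fun ⟨y, hy, hpair⟩ => ?_⟩
  · obtain ⟨y, hy, hpair⟩ := exists_seq_of_eventually_generic hA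
    exact ⟨fun i => y i, fun i => hy i, fun i j hij => hpair (Fin.val_ne_of_ne hij)⟩
  · obtain ⟨i, hi⟩ := exists_forall_v_sub_le (fun i j => hpair i j) Prod.fst P
      (by rw [Fintype.card_fin]; omega)
    filter_upwards [eventually_generic_mem, (Finset.eventually_all P).2 fun p _ =>
      eventually_generic_v_sub_le p.1] with b hb hbP
    refine (h.iff_of_v_sub_le hi hbP (le_v_sub_of_le_of_le (hy i).2 ?_)).1 (hy i).1
    rwa [v.map_sub_swap]

end IsCutBy

end Cut

section ZeroOne

open Filter

variable {L : FirstOrder.Language.{u₁, u₂}} {K : Type w} [Field K] [L.Structure K]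
  {Γ : Type w'} [AddCommGroup Γ] [LinearOrder Γ] [IsOrderedAddMonoid Γ]
  {v : AddValuation K (WithTop Γ)} {α : Type w} [FinitePower K α]

theorem DefPred.eventually_nearZero [DefinableValuation L v]
    [Fact (Function.Surjective v)] {R : α → K → Prop}
    (hR : DefPred L K fun p : α × K => R p.1 p.2) :
    DefPred L K fun a => ∀ᶠ b in nearZero v, R a b := by
  have iff_ex (a : α) : (∀ᶠ b in nearZero v, R a b) ↔
      ∃ d, d ≠ (0 : K) ∧ ∀ b, b ≠ 0 → v d ≤ v b → R a b := by
    rw [_root_.eventually_nearZero]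
    refine ⟨fun ⟨δ, hδ⟩ => ?_, fun ⟨d, hd, h⟩ => ?_⟩
    · obtain ⟨d, hd⟩ := (Fact.out : Function.Surjective v) δ
      exact ⟨d, ne_zero_of_v_eq_coe hd, by rwa [hd]⟩
    · obtain ⟨δ, hδ⟩ := exists_coe_eq_v (v := v) hd
      exact ⟨δ, by rwa [← hδ]⟩
  simp only [iff_ex]
  exact .ex (.and (.not DefMap.eq) (.all (.imp (.not DefMap.eq) (.imp (DefVal.le v)
    (DefPred.comp₂ hR)))))

variable [UniformlyCMinimal L v]

namespace DefPred

section

variable (v) {A : K → Prop}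
include v

theorem exists_isCutBy (hA : DefPred L K A) : ∃ P : Finset (K × K), IsCutBy v P A := by
  obtain ⟨N, hN⟩ := UniformlyCMinimal.exists_cut (v := v) (R := fun _ : K => A)
    (DefPred.comp hA (by fun_prop))
  obtain ⟨P, -, hP⟩ := hN 0
  exact ⟨P, hP⟩

theorem exists_openBall_of_infinite (hA : DefPred L K A) (hinf : {x | A x}.Infinite) :
    ∃ x, ∃ γ : Γ, ∀ y ∈ openBall v x (γ : WithBot Γ), A y := by
  classical
  obtain ⟨P, hP⟩ := hA.exists_isCutBy v
  obtain ⟨x, hx, hxP⟩ := hinf.exists_notMem_finset (P.image Prod.fst)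
  obtain ⟨γ, hγ⟩ := hP.exists_openBall (x := x) fun p hp h =>
    hxP (Finset.mem_image.2 ⟨p, hp, h.symm⟩)
  exact ⟨x, γ, fun y hy => (hγ y hy).1 hx⟩

variable [Nontrivial Γ] in
theorem eventuallyConst_nearZero (hA : DefPred L K A) : EventuallyConst A (nearZero v) := by
  obtain ⟨P, hP⟩ := hA.exists_isCutBy v
  refine hP.eventuallyConst fun p _ => eventuallyConst_iff_exists_eventuallyEq.2 ?_
  rcases eq_or_ne p.1 0 with h | h
  · rcases eq_or_ne p.2 0 with h' | h'
    · refine ⟨.gt, eventually_nearZero_ne.mono fun b hb => ?_⟩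
      rw [cmp_eq_gt_iff, h, h', sub_zero, v.map_zero]
      exact ((v.ne_top_iff).2 hb).lt_top
    · obtain ⟨γ, hγ⟩ := exists_coe_eq_v (v := v) h'
      refine ⟨.lt, (eventually_nearZero_lt γ).mono fun b hb => ?_⟩
      rwa [cmp_eq_lt_iff, h, hγ, sub_zero]
  · obtain ⟨γ, hγ⟩ := exists_coe_eq_v (v := v) h
    refine ⟨cmp (v p.2) γ, (eventually_nearZero_lt γ).mono fun b hb => ?_⟩
    have heq : v (b - p.1) = γ := by rw [v.map_sub_eq_of_lt_right (by rwa [hγ]), hγ]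
    exact congrArg _ heq

theorem eventuallyConst_generic (hA : DefPred L K A) (a : K) (γ : WithTop Γ) :
    EventuallyConst A (generic v a γ) := by
  obtain ⟨P, hP⟩ := hA.exists_isCutBy v
  refine hP.eventuallyConst fun p _ => eventuallyConst_iff_exists_eventuallyEq.2 ?_
  rcases lt_or_ge (v (a - p.1)) γ with hlt | hle
  · refine ⟨cmp (v p.2) (v (a - p.1)), eventually_generic_mem.mono fun b hb => ?_⟩
    have heq : v (b - p.1) = v (a - p.1) :=
      v_sub_eq_of_lt (hlt.trans_le (v.map_sub_swap b a ▸ hb))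
    exact congrArg _ heq
  · refine ⟨cmp (v p.2) γ, ?_⟩
    filter_upwards [eventually_generic_mem, eventually_generic_v_sub_le p.1] with b hb hbp
    exact congrArg _ (hbp.antisymm (le_v_sub_of_le_of_le hb hle))

end

variable {R : α → K → Prop} (hR : DefPred L K fun p : α × K => R p.1 p.2)
include hR

theorem eventually_generic [IsAlgClosed K] [DefinableField L K] [DefinableValuation L v]
    [Fact (Function.Surjective v)] {c : α → K} (hc : DefMap L K c) {g : α → WithTop Γ}
    (hg : DefVal L v g) : DefPred L K fun a => ∀ᶠ b in generic v (c a) (g a), R a b := by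
  obtain ⟨N, hN⟩ := UniformlyCMinimal.exists_cut (v := v) hR
  have iff_ex (a : α) : (∀ᶠ b in generic v (c a) (g a), R a b) ↔ ∃ y : Fin (N + 1) → K,
      (∀ i, R a (y i) ∧ g a ≤ v (y i - c a)) ∧ ∀ i j, i ≠ j → v (y i - y j) ≤ g a := by
    obtain ⟨P, hPN, hP⟩ := hN a
    exact hP.eventually_generic_iff hPN
  simp only [iff_ex]
  exact .ex (.and (.forall_finite fun i => .and (DefPred.comp₂ hR) (DefVal.le v))
    (.forall_finite fun i => .forall_finite fun j => .forall_finite fun _ => DefVal.le v))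

end DefPred

theorem DefPred.eventually_generic_openBall {A : K → Prop} (hA : DefPred L K A) {a : K} {γ : Γ}
    (h : ∀ᶠ b in generic v a γ, A b) :
    ∀ᶠ b in generic v a γ, ∀ t ∈ openBall v b (γ : WithBot Γ), A t := by
  obtain ⟨P, hP⟩ := hA.exists_isCutBy v
  filter_upwards [h, (Finset.eventually_all P).2 fun p _ => eventually_generic_v_sub_le p.1]
    with b hb hbP t ht
  exact (hP.iff_of_lt_v_sub hbP (by rw [v.map_sub_swap]; exact mem_openBall_coe.1 ht)).1 hb

variable [IsAlgClosed K] [Fact (Function.Surjective v)]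

/-- Among sufficiently many generic `x` the cut points of `R · y` miss one. -/
theorem DefPred.eventually_generic_comm {R : K → K → Prop}
    (hR : DefPred L K fun p : K × K => R p.1 p.2) {a : K} {γ : WithTop Γ}
    (h : ∀ᶠ x in generic v a γ, ∀ᶠ y in generic v a γ, R x y) :
    ∀ᶠ y in generic v a γ, ∀ᶠ x in generic v a γ, R x y := by
  obtain ⟨N, hN⟩ := UniformlyCMinimal.exists_cut (v := v) (R := fun y x : K => R x y)
    (DefPred.comp₂ hR)
  obtain ⟨x, hx, hpair⟩ := exists_seq_of_eventually_generic h
  have rel : ∀ᶠ y in generic v a γ, ∀ i ≤ N, R (x i) y :=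
    (Set.finite_Iic N).eventually_all.2 fun i _ => (hx i).1
  filter_upwards [rel] with y hy
  obtain ⟨P, hPN, hP⟩ := hN y
  exact (hP.eventually_generic_iff hPN).2 ⟨fun i => x i,
    fun i => ⟨hy i (Nat.le_of_lt_succ i.2), (hx i).2⟩, fun i j hij => hpair (Fin.val_ne_of_ne hij)⟩

variable [DefinableField L K] [DefinableValuation L v]

theorem DefPred.eventually_generic_of_total {R : K → K → Prop}
    (hR : DefPred L K fun p : K × K => R p.1 p.2) (htot : ∀ x y, R x y ∨ R y x) (a : K)
    (γ : WithTop Γ) : ∀ᶠ x in generic v a γ, ∀ᶠ y in generic v a γ, R x y ∧ R y x := by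
  have hdef : DefPred L K fun x => ∀ᶠ y in generic v a γ, R x y :=
    hR.eventually_generic (.const a) (.const γ)
  have key : ∀ᶠ x in generic v a γ, ∀ᶠ y in generic v a γ, R x y := by
    refine (eventuallyConst_pred.1 (hdef.eventuallyConst_generic v a γ)).elim id fun h => ?_
    refine DefPred.eventually_generic_comm (R := fun x y => R y x) (DefPred.comp₂ hR)
      (h.mono fun x hx => ?_)
    have hRx : DefPred L K (R x) := DefPred.comp₂ hR
    refine ((eventuallyConst_pred.1 (hRx.eventuallyConst_generic v a γ)).resolve_left hx).mono ?_
    exact fun y hy => (htot x y).resolve_left hy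
  exact (key.and (hR.eventually_generic_comm key)).mono fun x hx => hx.1.and hx.2

theorem DefVal.eventuallyConst_generic {H : K → WithTop Γ} (hH : DefVal L v H) (a : K)
    (γ : WithTop Γ) : EventuallyConst H (generic v a γ) := by
  obtain ⟨x, hx⟩ := (DefPred.eventually_generic_of_total (L := L) (v := v)
    (R := fun x y => H x ≤ H y) (DefVal.le v) (fun x y => le_total _ _) a γ).exists
  exact eventuallyConst_iff_exists_eventuallyEq.2
    ⟨H x, hx.mono fun y hy => (hy.1.antisymm hy.2).symm⟩

theorem DefPred.exists_openBall_of_total_preorder [Nontrivial Γ] {R : K → K → Prop}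
    [IsTrans K R] (hR : DefPred L K fun p : K × K => R p.1 p.2) (htot : ∀ x y, R x y ∨ R y x)
    (a : K) (γ : Γ) : ∃ (b : K) (δ : Γ),
      openBall v b (δ : WithBot Γ) ⊆ openBall v a (γ : WithBot Γ) ∧
      ∀ x ∈ openBall v b (δ : WithBot Γ), ∀ y ∈ openBall v b (δ : WithBot Γ), R x y := by
  obtain ⟨δ, hδ⟩ := exists_gt γ
  obtain ⟨x, hx⟩ := (hR.eventually_generic_of_total (v := v) htot a δ).exists
  have hdef : DefPred L K fun y => R x y ∧ R y x :=
    .and (DefPred.comp₂ hR) (DefPred.comp₂ hR)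
  obtain ⟨b, hball, hb⟩ := ((hdef.eventually_generic_openBall hx).and eventually_generic_mem).exists
  have hba : b ∈ openBall v a (γ : WithBot Γ) :=
    mem_openBall_coe.2 ((WithTop.coe_lt_coe.2 hδ).trans_le hb)
  exact ⟨b, δ, openBall_subset hba hδ.le, fun y hy z hz =>
    _root_.trans (hball y hy).2 (hball z hz).1⟩

end ZeroOne

section ValueFunctions

open Filter

namespace EventuallyQLinear

variable {Γ : Type w'} [AddCommGroup Γ] [LinearOrder Γ] {g g' : Γ → Γ}

theorem congr (hg : EventuallyQLinear g) (h : ∀ᶠ γ in atTop, g γ = g' γ) :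
    EventuallyQLinear g' := by
  obtain ⟨δ, α, r, hr⟩ := hg
  obtain ⟨δ', hδ'⟩ := eventually_atTop.1 h
  refine ⟨max δ δ', α, r, fun γ hγ => ?_⟩
  rw [max_lt_iff] at hγ
  rw [← hδ' γ hγ.2.le, hr γ hγ.1]

theorem eventually_const_of_bounded [IsOrderedAddMonoid Γ] [Nontrivial Γ]
    (hg : EventuallyQLinear g) {β σ : Γ} (hb : ∀ᶠ γ in atTop, β ≤ g γ ∧ g γ ≤ σ) :
    ∃ κ, ∀ᶠ γ in atTop, g γ = κ := by
  obtain ⟨δ, α, r, hr⟩ := hg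
  have slope : r.num = 0 := by
    obtain ⟨γ, ⟨hβ, hσ⟩, hδ, h0, hlo, hup⟩ := (hb.and <| (eventually_gt_atTop δ).and <|
      (eventually_gt_atTop 0).and <| (eventually_gt_atTop (-(r.den • (β - α)))).and <|
      eventually_gt_atTop (r.den • (σ - α))).exists
    have lower : r.den • (β - α) ≤ r.num • γ :=
      hr γ hδ ▸ nsmul_le_nsmul_right (sub_le_sub_right hβ α) _
    have upper : r.num • γ ≤ r.den • (σ - α) :=
      hr γ hδ ▸ nsmul_le_nsmul_right (sub_le_sub_right hσ α) _
    by_contra hne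
    rcases lt_or_gt_of_ne hne with hneg | hpos
    · have : r.num • γ ≤ (-1 : ℤ) • γ := zsmul_le_zsmul_left h0.le (by omega)
      rw [neg_one_zsmul] at this
      exact (lower.trans this).not_gt (neg_lt.1 hlo)
    · have : (1 : ℤ) • γ ≤ r.num • γ := zsmul_le_zsmul_left h0.le (by omega)
      rw [one_zsmul] at this
      exact (this.trans upper).not_gt hup
  refine ⟨α, (eventually_gt_atTop δ).mono fun γ hγ => sub_eq_zero.1 ?_⟩
  have := hr γ hγ
  rwa [slope, zero_zsmul, nsmul_eq_zero_iff_right r.den_ne_zero] at this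

end EventuallyQLinear

section

variable {K : Type w} [Field K] {Γ : Type w'} [AddCommGroup Γ] [LinearOrder Γ]
  [IsOrderedAddMonoid Γ] {v : AddValuation K (WithTop Γ)}

theorem eventually_generic_zero_of_nearZero {A : K → Prop} (h : ∀ᶠ b in nearZero v, A b) :
    ∀ᶠ γ : Γ in atTop, ∀ᶠ b in generic v 0 γ, A b := by
  obtain ⟨δ, hδ⟩ := eventually_nearZero.1 h
  filter_upwards [eventually_ge_atTop δ] with γ hγ
  filter_upwards [eventually_generic_mem, eventually_generic_v_sub_le 0] with b hb hb0
  rw [sub_zero] at hb hb0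
  exact hδ b (ne_zero_of_v_eq_coe (hb0.antisymm hb)) ((WithTop.coe_le_coe.2 hγ).trans hb)

end

/-- The definable functions from the value group to itself are eventually `ℚ`-linear. -/
class QLinearValueGroup (L : FirstOrder.Language.{u₁, u₂}) {K : Type w} [Field K] {Γ : Type w'}
    [AddCommGroup Γ] [LinearOrder Γ] [IsOrderedAddMonoid Γ] (v : AddValuation K (WithTop Γ))
    [L.Structure K] : Prop where
  eventuallyQLinear : ∀ g : Γ → Γ, IsDefinableGammaFun v L g → EventuallyQLinear g

variable {L : FirstOrder.Language.{u₁, u₂}} {K : Type w} [Field K] [L.Structure K]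
  {Γ : Type w'} [AddCommGroup Γ] [LinearOrder Γ] [IsOrderedAddMonoid Γ]
  {v : AddValuation K (WithTop Γ)}

theorem DefPred.isDefinableGammaFun {g : Γ → Γ} (h : DefPred L K fun p : K × K =>
    ∃ γ : Γ, v p.1 = (γ : WithTop Γ) ∧ v p.2 = (g γ : WithTop Γ)) : IsDefinableGammaFun v L g :=
  Set.Definable.preimage_comp (Sum.elim (fun _ : Unit => (0 : Fin 2)) fun _ : Unit => 1) h

variable [DefinableValuation L v] [Fact (Function.Surjective v)]

/-- Only the germ of `g` at infinity matters, so `g` may be cut off at `δ`. -/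
theorem DefVal.eventuallyQLinear [Nontrivial Γ] [QLinearValueGroup L v] {G : K → WithTop Γ}
    (hG : DefVal L v G) {g : Γ → Γ}
    (h : ∀ᶠ γ : Γ in atTop, ∀ c, v c = (γ : WithTop Γ) → G c = g γ) : EventuallyQLinear g := by
  classical
  obtain ⟨δ, hδ⟩ := eventually_atTop.1 h
  refine (QLinearValueGroup.eventuallyQLinear (L := L) (v := v)
    (fun γ : Γ => if δ ≤ γ then g γ else 0) (DefPred.isDefinableGammaFun ?_)).congr
    ((eventually_ge_atTop δ).mono fun γ hγ => if_pos hγ)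
  have graph (p : K × K) : (∃ γ : Γ, v p.1 = γ ∧ v p.2 = ((if δ ≤ γ then g γ else 0 : Γ))) ↔
      v p.1 ≠ ⊤ ∧ ((δ ≤ v p.1 ∧ v p.2 = G p.1) ∨ (v p.1 < δ ∧ v p.2 = 0)) := by
    rcases eq_or_ne (v p.1) ⊤ with htop | htop
    · simp [htop]
    · obtain ⟨γ, hγ⟩ := WithTop.ne_top_iff_exists.1 htop
      rcases le_or_gt δ γ with hle | hlt
      · simp [← hγ, hδ γ hle p.1 hγ.symm, hle, hle.not_gt, WithTop.coe_inj]
      · simp [← hγ, hlt, hlt.not_ge]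
  simp only [graph]
  exact .and (.not (DefVal.eq v)) (.or (.and (DefVal.le v) (DefVal.eq v))
    (.and (DefVal.lt v) (DefVal.eq v)))

theorem DefVal.exists_generic_value [DefinableField L K] [IsAlgClosed K] [UniformlyCMinimal L v]
    {H : K → WithTop Γ} (hH : DefVal L v H) : ∃ η : WithTop Γ → WithTop Γ,
      DefVal L v (fun c => η (v c)) ∧ ∀ γ, ∀ᶠ b in generic v 0 γ, H b = η γ := by
  choose η hη using fun γ =>
    eventuallyConst_iff_exists_eventuallyEq.1 (hH.eventuallyConst_generic 0 γ)
  refine ⟨η, ?_, hη⟩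
  have le_iff (p : K × K) : v p.2 ≤ η (v p.1) ↔ ∀ᶠ b in generic v 0 (v p.1), v p.2 ≤ H b :=
    ⟨fun h => (hη _).mono fun b hb => h.trans_eq hb.symm, fun h => by
      obtain ⟨b, hb, hbη⟩ := (h.and (hη _)).exists
      exact hb.trans_eq hbη⟩
  simp only [DefVal, le_iff]
  exact DefPred.eventually_generic (DefVal.le v) (by fun_prop) (by fun_prop)

/-- The generic value of `H` on a sphere around `0` is a definable function of the radius, hence
eventually `ℚ`-linear. -/
theorem DefVal.exists_eventually_eq_of_bounded [Nontrivial Γ] [DefinableField L K] [IsAlgClosed K]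
    [UniformlyCMinimal L v] [QLinearValueGroup L v] {H : K → WithTop Γ} (hH : DefVal L v H)
    {β σ : Γ} (hb : ∀ᶠ b in nearZero v, β ≤ H b ∧ H b ≤ σ) :
    ∃ κ : Γ, ∀ᶠ b in nearZero v, H b = κ := by
  obtain ⟨η, hηdef, hη⟩ := hH.exists_generic_value
  have bounded : ∀ᶠ γ : Γ in atTop, β ≤ η γ ∧ η γ ≤ σ := by
    filter_upwards [eventually_generic_zero_of_nearZero hb] with γ hγ
    obtain ⟨b, hb, hbη⟩ := (hγ.and (hη γ)).exists
    rwa [hbη] at hb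
  have coe_untop : ∀ᶠ γ : Γ in atTop, (((η γ).untopD 0 : Γ) : WithTop Γ) = η γ :=
    bounded.mono fun γ hγ => by
      obtain ⟨ε, hε⟩ := WithTop.ne_top_iff_exists.1 (hγ.2.trans_lt (WithTop.coe_lt_top σ)).ne
      rw [← hε, WithTop.untopD_coe]
  have qLinear : EventuallyQLinear fun γ : Γ => (η γ).untopD 0 :=
    hηdef.eventuallyQLinear (coe_untop.mono fun γ hγ c hc => by rw [hc, hγ])
  obtain ⟨κ, hκ⟩ := qLinear.eventually_const_of_bounded (β := β) (σ := σ) <| by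
    filter_upwards [bounded, coe_untop] with γ hγ hcoe
    exact ⟨by exact_mod_cast hγ.1.trans_eq hcoe.symm, by exact_mod_cast hcoe.trans_le hγ.2⟩
  have hdef : DefPred L K fun b => H b = κ := DefVal.eq v
  refine ⟨κ, (eventuallyConst_pred.1 (hdef.eventuallyConst_nearZero v)).resolve_right ?_⟩
  intro hne
  obtain ⟨γ, hγ, hcoe, hκγ⟩ :=
    ((eventually_generic_zero_of_nearZero hne).and (coe_untop.and hκ)).exists
  obtain ⟨b, hbne, hb⟩ := (hγ.and (hη γ)).exists
  exact hbne (by rw [hb, ← hcoe, hκγ])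

theorem DefVal.exists_germ [DefinableField L K] {α : Type w} [FinitePower K α]
    {Φ : α → K → WithTop Γ} (hΦ : DefVal L v fun p : α × K => Φ p.1 p.2) :
    ∃ H : α → WithTop Γ, DefVal L v H ∧ ∀ a κ, (∀ᶠ b in nearZero v, Φ a b = κ) → H a = κ := by
  have germ (a : α) : ∃ η, (∀ z, v z ≤ η ↔
      ((∃ c, ∀ᶠ b in nearZero v, Φ a b = v c) → ∀ᶠ b in nearZero v, v z ≤ Φ a b)) ∧
      ∀ κ, (∀ᶠ b in nearZero v, Φ a b = κ) → η = κ := by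
    by_cases h : ∃ c, ∀ᶠ b in nearZero v, Φ a b = v c
    · obtain ⟨c, hc⟩ := h
      have le_iff (z : K) : v z ≤ v c ↔ ∀ᶠ b in nearZero v, v z ≤ Φ a b :=
        eventually_const.symm.trans (eventually_congr (hc.mono fun b hb => by rw [hb]))
      refine ⟨v c, fun z => ⟨fun hz _ => (le_iff z).1 hz, fun hz => (le_iff z).2 (hz ⟨c, hc⟩)⟩, ?_⟩
      intro κ hκ
      obtain ⟨b, hb, hbκ⟩ := (hc.and hκ).exists
      rw [← hb, hbκ]
    · refine ⟨⊤, fun z => by simp only [h, le_top, IsEmpty.forall_iff], fun κ hκ => ?_⟩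
      obtain ⟨c, rfl⟩ := (Fact.out : Function.Surjective v) κ
      exact absurd ⟨c, hκ⟩ h
  choose H hle hH using germ
  refine ⟨H, ?_, hH⟩
  simp only [DefVal, hle]
  refine .imp (.ex ?_) (DefPred.eventually_nearZero
    (R := fun (p : α × K) b => v p.2 ≤ Φ p.1 b) (DefVal.le v))
  exact DefPred.eventually_nearZero (R := fun (p : (α × K) × K) b => Φ p.1.1 b = v p.2)
    (DefVal.eq v)

end ValueFunctions

section Limits

open Filter

variable {L : FirstOrder.Language.{u₁, u₂}} {K : Type w} [Field K] [L.Structure K]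
  {Γ : Type w'} [AddCommGroup Γ] [LinearOrder Γ] [IsOrderedAddMonoid Γ]
  {v : AddValuation K (WithTop Γ)} [Fact (Function.Surjective v)]

theorem IsDefinablyComplete.exists_of_nested [Nontrivial Γ] (hcomplete : IsDefinablyComplete v L)
    {R : K → K → Prop} (hR : DefPred L K fun p : K × K => R p.1 p.2)
    (hball : ∀ c, ∀ γ : Γ, v c = γ → ∃ z, ∀ t, R c t ↔ γ < v (t - z))
    (hanti : ∀ c d t, v c ≤ v d → R d t → R c t) : ∃ l, ∀ c ≠ 0, R c l := by
  let W : Set (Fin 1 → K) := {w | w 0 ≠ 0}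
  let X : Set ((Fin 1 → K) × K) := {p | p.1 0 ≠ 0 ∧ R (p.1 0) p.2}
  have fiber_eq (w : Fin 1 → K) (hw : w ∈ W) (γ : Γ) (hγ : v (w 0) = γ) :
      ∃ z, fiber X w = openBall v z (γ : WithBot Γ) := by
    obtain ⟨z, hz⟩ := hball _ γ hγ
    refine ⟨z, Set.ext fun t => ?_⟩
    rw [mem_openBall_coe, ← hz]
    exact and_iff_right hw
  have fiber_eq' (w : Fin 1 → K) (hw : w ∈ W) :
      ∃ (z : K) (γ : Γ), fiber X w = openBall v z (γ : WithBot Γ) := by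
    obtain ⟨γ, hγ⟩ := exists_coe_eq_v (v := v) hw
    obtain ⟨z, hz⟩ := fiber_eq w hw γ hγ
    exact ⟨z, γ, hz⟩
  have fiber_subset {w w' : Fin 1 → K} (hw : w ∈ W) (hle : v (w 0) ≤ v (w' 0)) :
      fiber X w' ⊆ fiber X w := fun t ht => ⟨hw, hanti _ _ t hle ht.2⟩
  have family : IsDefinableFamily L W X := by
    refine ⟨?_, definableProd_iff_defPred.2 ?_, ?_⟩
    · have : DefPred L K fun w : Fin 1 → K => w 0 ≠ 0 := .not DefMap.eq
      exact this
    · exact .and (.not DefMap.eq) (DefPred.comp₂ hR)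
    · refine Set.Subset.antisymm (Set.image_subset_iff.2 fun p hp => hp.1) fun w hw => ?_
      obtain ⟨z, γ, hz⟩ := fiber_eq' w hw
      exact ⟨(w, z), hz.ge mem_openBall_self, rfl⟩
  obtain ⟨l, hl⟩ := hcomplete 1 W X family
    (fun w hw => by
      obtain ⟨z, γ, hz⟩ := fiber_eq' w hw
      exact Or.inr ⟨z, γ, hz⟩)
    (fun w hw w' hw' => (le_total (v (w' 0)) (v (w 0))).imp (fiber_subset hw') (fiber_subset hw))
    (fun γ => by
      obtain ⟨δ, hδ⟩ := exists_gt γ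
      obtain ⟨c, hc⟩ := (Fact.out : Function.Surjective v) δ
      obtain ⟨z, hz⟩ := fiber_eq (fun _ => c) (ne_zero_of_v_eq_coe hc) δ hc
      exact ⟨_, ne_zero_of_v_eq_coe hc, Or.inr ⟨z, δ, WithBot.coe_lt_coe.2 hδ, hz⟩⟩)
  exact ⟨l, fun c hc => (Set.mem_iInter₂.1 hl (fun _ => c) hc).2⟩

variable [DefinableField L K] [DefinableValuation L v] [UniformlyCMinimal L v] {h : K → K}
  (hh : DefMap L K h)
include hh

/-- The `κ`-neighbourhood of `h '' {b | v d ≤ v b}` is cut out by a number of balls bounded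
independently of `d`. But a value `h (y' j)` with `v d ≤ v (y' j)`, and a value `h (y i)` at
distance `κ` from all such values, can be found which these balls do not separate. -/
theorem DefMap.not_eventually_v_sub_eq (κ : Γ) :
    ¬ ∀ᶠ a in nearZero v, ∀ᶠ b in nearZero v, v (h a - h b) = κ := by
  intro hκ
  obtain ⟨N, hN⟩ := UniformlyCMinimal.exists_cut (L := L) (v := v)
    (R := fun d z : K => ∃ b, b ≠ 0 ∧ v d ≤ v b ∧ κ < v (h b - z))
    (.ex (.and (.not DefMap.eq) (.and (DefVal.le v) (DefVal.lt v))))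
  have : Std.Symm fun x y : K => v (h x - h y) = κ := ⟨fun x y h => by rwa [v.map_sub_swap]⟩
  have pairwise_le {y : ℕ → K} (hy : Pairwise fun i j => v (h (y i) - h (y j)) = κ) :
      Pairwise fun i j : Fin (N + 1) => v (h (y i) - h (y j)) ≤ κ :=
    fun i j hij => (hy (Fin.val_ne_of_ne hij)).le
  obtain ⟨y, hy, hydist⟩ := exists_seq_pairwise_of_eventually
    (r := fun x y => v (h x - h y) = κ) hκ fun _ h => h
  obtain ⟨δ, hδ⟩ := eventually_nearZero.1 <|
    (Set.finite_Iic N).eventually_all.2 fun i _ => hy i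
  obtain ⟨d, hd⟩ := (Fact.out : Function.Surjective v) δ
  obtain ⟨y', hy', hydist'⟩ := exists_seq_pairwise_of_eventually
    (r := fun x y => v (h x - h y) = κ) (hκ.and (eventually_nearZero (v := v)
      (A := fun b => b ≠ 0 ∧ v d ≤ v b).2 ⟨δ, fun b hb hle => ⟨hb, hd ▸ hle⟩⟩)) fun _ h => h.1
  obtain ⟨P, hPN, hP⟩ := hN d
  have card_lt : P.card < Fintype.card (Fin (N + 1)) := by rw [Fintype.card_fin]; omega
  obtain ⟨i, hi⟩ := exists_forall_v_sub_le (pairwise_le hydist) Prod.fst P card_lt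
  obtain ⟨j, hj⟩ := exists_forall_v_sub_le (pairwise_le hydist') Prod.fst P card_lt
  have dist (b : K) (hb : b ≠ 0) (hdb : v d ≤ v b) : v (h b - h (y i)) = κ := by
    rw [v.map_sub_swap]
    exact hδ b hb (hd ▸ hdb) i (Nat.le_of_lt_succ i.2)
  have hj' := (hy' j).2
  obtain ⟨b, hb, hdb, hlt⟩ := (hP.iff_of_v_sub_le hj hi (dist _ hj'.1 hj'.2).ge).1
    ⟨y' j, hj'.1, hj'.2, by simp⟩
  exact hlt.ne' (dist b hb hdb)

variable [Nontrivial Γ] [IsAlgClosed K] [QLinearValueGroup L v]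

theorem DefMap.exists_eventually_lt_v_sub {β : Γ}
    (hβ : ∀ᶠ b in nearZero v, β ≤ v (h b)) (σ : Γ) :
    ∃ z, ∀ᶠ b in nearZero v, σ < v (h b - z) := by
  by_contra! hcon
  have far (z : K) : ∀ᶠ b in nearZero v, v (h b - z) ≤ σ := by
    have hdef : DefPred L K fun b => σ < v (h b - z) := DefVal.lt v
    refine ((eventuallyConst_pred.1 (hdef.eventuallyConst_nearZero v)).resolve_left ?_).mono
      fun _ => not_lt.1
    exact fun hz => (hcon z) (hz.mono fun _ hb => hb.not_ge)
  have bounded {a : K} (ha : β ≤ v (h a)) :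
      ∀ᶠ b in nearZero v, β ≤ v (h b - h a) ∧ v (h b - h a) ≤ σ :=
    (hβ.mono fun b hb => v.map_le_sub hb ha).and (far _)
  obtain ⟨H, hH, germ⟩ := DefVal.exists_germ (Φ := fun a b => v (h b - h a)) (L := L)
    (v := v) (by fun_prop)
  have hdist {a : K} (ha : β ≤ v (h a)) : ∀ᶠ b in nearZero v, v (h b - h a) = H a := by
    have hdef : DefVal L v fun b => v (h b - h a) := by fun_prop
    obtain ⟨κ, hκ⟩ := hdef.exists_eventually_eq_of_bounded (bounded ha)
    rwa [germ a κ hκ]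
  obtain ⟨κ, hκ⟩ := hH.exists_eventually_eq_of_bounded (β := β) (σ := σ) <| hβ.mono fun a ha => by
    obtain ⟨b, hb, hbH⟩ := ((bounded ha).and (hdist ha)).exists
    rwa [hbH] at hb
  refine hh.not_eventually_v_sub_eq κ <|
    (hβ.and hκ).mono fun a ha => (hdist ha.1).mono fun b hb => ?_
  rw [v.map_sub_swap, hb, ha.2]

theorem DefMap.exists_limit_nearZero (hcomplete : IsDefinablyComplete v L) {β : Γ}
    (hβ : ∀ᶠ b in nearZero v, β ≤ v (h b)) :
    ∃ l, ∀ σ : Γ, ∀ᶠ b in nearZero v, σ < v (h b - l) := by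
  have hdef : DefPred L K fun p : K × K => ∀ᶠ b in nearZero v, v p.1 < v (h b - p.2) :=
    DefPred.eventually_nearZero (R := fun (p : K × K) b => v p.1 < v (h b - p.2)) (DefVal.lt v)
  have ball (c : K) (σ : Γ) (hc : v c = σ) :
      ∃ z, ∀ t, (∀ᶠ b in nearZero v, v c < v (h b - t)) ↔ σ < v (t - z) := by
    obtain ⟨z, hz⟩ := hh.exists_eventually_lt_v_sub hβ σ
    refine ⟨z, fun t => ⟨fun ht => ?_, fun ht => hz.mono fun b hb => ?_⟩⟩
    · obtain ⟨b, hbt, hbz⟩ := (ht.and hz).exists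
      exact lt_v_sub_of_lt_of_lt (v.map_sub_swap t _ ▸ hc ▸ hbt) hbz
    · exact hc ▸ lt_v_sub_of_lt_of_lt hb (v.map_sub_swap t z ▸ ht)
  obtain ⟨l, hl⟩ := hcomplete.exists_of_nested hdef ball
    fun c d t hle ht => ht.mono fun b hb => hle.trans_lt hb
  refine ⟨l, fun σ => ?_⟩
  obtain ⟨c, hc⟩ := (Fact.out : Function.Surjective v) σ
  simpa only [hc] using hl c (ne_zero_of_v_eq_coe hc)

end Limits

section Uniformity

open Filter

section

variable {K : Type w} [Field K] {Γ : Type w'} [AddCommGroup Γ] [LinearOrder Γ]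
  [IsOrderedAddMonoid Γ] {v : AddValuation K (WithTop Γ)}

theorem infinite_openBall [IsAlgClosed K] [Nontrivial Γ] [Fact (Function.Surjective v)] (a : K)
    (γ : Γ) : (openBall v a (γ : WithBot Γ)).Infinite := by
  intro hfin
  obtain ⟨δ, hδ⟩ := exists_gt γ
  obtain ⟨b, hb, hfar⟩ := (eventually_generic_mem.and <| hfin.eventually_all.2 fun q _ =>
    eventually_generic_v_sub_le (v := v) (a := a) (γ := δ) q).exists
  have := hfar b (mem_openBall_coe.2 ((WithTop.coe_lt_coe.2 hδ).trans_le hb))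
  rw [sub_self, v.map_zero] at this
  exact (WithTop.coe_lt_top δ).not_ge this

theorem exists_seq_disjoint_openBall [IsAlgClosed K] [Nontrivial Γ]
    [Fact (Function.Surjective v)] (a : K) (γ : Γ) : ∃ (b : ℕ → K) (δ : Γ),
    (∀ i, openBall v (b i) (δ : WithBot Γ) ⊆ openBall v a (γ : WithBot Γ)) ∧
      Pairwise fun i j =>
        Disjoint (openBall v (b i) (δ : WithBot Γ)) (openBall v (b j) (δ : WithBot Γ)) := by
  obtain ⟨δ, hδ⟩ := exists_gt γ
  obtain ⟨b, hb, hpair⟩ := exists_seq_of_eventually_generic (v := v) (a := a) (γ := δ)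
    (Eventually.of_forall fun _ => trivial)
  refine ⟨b, δ, fun i => openBall_subset
    (mem_openBall_coe.2 ((WithTop.coe_lt_coe.2 hδ).trans_le (hb i).2)) hδ.le, fun i j hij =>
    Set.disjoint_left.2 fun x hi hj => (hpair hij).not_gt (lt_v_sub_of_lt_of_lt (y := x) ?_
      (mem_openBall_coe.1 hj))⟩
  rw [v.map_sub_swap]
  exact mem_openBall_coe.1 hi

end

variable {L : FirstOrder.Language.{u₁, u₂}} {K : Type w} [Field K] [L.Structure K]
  {Γ : Type w'} [AddCommGroup Γ] [LinearOrder Γ] [IsOrderedAddMonoid Γ]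
  {v : AddValuation K (WithTop Γ)} [UniformlyCMinimal L v]

theorem DefPred.eventually_generic_exists {R : K → K → Prop}
    (hR : DefPred L K fun p : K × K => R p.1 p.2) {B : Set K} (hinf : B.Infinite)
    (hfin : ∀ z, {x ∈ B | R z x}.Finite) {g : K → K} {κ : Γ}
    (hg : ∀ x ∈ B, κ ≤ v (g x)) (hRg : ∀ x ∈ B, ∀ z, κ < v (g x - z) → R z x) :
    ∀ᶠ z in generic v 0 κ, ∃ x, R z x := by
  refine (eventuallyConst_pred.1 ((DefPred.ex hR).eventuallyConst_generic v 0
    κ)).resolve_right fun hmiss => ?_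
  obtain ⟨Q, hQ⟩ := _root_.eventually_generic.1 hmiss
  refine hinf ((Q.finite_toSet.biUnion fun q _ => hfin q).subset fun x hx => ?_)
  obtain ⟨q, hq, hlt⟩ : ∃ q ∈ Q, κ < v (g x - q) := by
    by_contra! hfar
    exact hQ (g x) (by rw [sub_zero]; exact hg x hx) hfar ⟨x, hRg x hx _ (by simp)⟩
  exact Set.mem_biUnion (Finset.mem_coe.2 hq) ⟨hx, hRg x hx q hlt⟩

variable [Nontrivial Γ] [IsAlgClosed K] [Fact (Function.Surjective v)]

variable (v) in
include v in
theorem DefPred.exists_ncard_le_of_finite {α : Type w} [FinitePower K α] {R : α → K → Prop}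
    (hR : DefPred L K fun p : α × K => R p.1 p.2) :
    ∃ N, ∀ a, {x | R a x}.Finite → {x | R a x}.ncard ≤ N := by
  classical
  obtain ⟨N, hN⟩ := UniformlyCMinimal.exists_cut (v := v) hR
  refine ⟨N, fun a hfin => ?_⟩
  obtain ⟨P, hPN, hP⟩ := hN a
  have centre (x : K) (hx : R a x) : x ∈ P.image Prod.fst := by
    by_contra hxP
    obtain ⟨γ, hγ⟩ := hP.exists_openBall (x := x) fun p hp h =>
      hxP (Finset.mem_image.2 ⟨p, hp, h.symm⟩)
    exact infinite_openBall x γ (hfin.subset fun y hy => (hγ y hy).1 hx)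
  calc {x | R a x}.ncard ≤ (P.image Prod.fst).card := by
        rw [← Set.ncard_coe_finset]
        exact Set.ncard_le_ncard centre (Finset.finite_toSet _)
    _ ≤ N := Finset.card_image_le.trans hPN

variable [DefinableField L K] [DefinableValuation L v]

/-- If every residue class contained only finitely many values of `g`, then a generic class would
contain values of `g` on each of the members of an infinite family of disjoint balls, against
uniform finiteness. -/
theorem DefPred.exists_openBall_forall_of_residue {E : K → K → Prop}
    (hE : DefPred L K fun p : K × K => E p.1 p.2) {g : K → K} {a : K} {γ κ : Γ}
    (hg : ∀ x ∈ openBall v a (γ : WithBot Γ), κ ≤ v (g x))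
    (hEg : ∀ x ∈ openBall v a (γ : WithBot Γ), ∀ z, κ < v (g x - z) → E z x) :
    ∃ (z b : K) (δ : Γ), openBall v b (δ : WithBot Γ) ⊆ openBall v a (γ : WithBot Γ) ∧
      ∀ x ∈ openBall v b (δ : WithBot Γ), E z x := by
  by_contra! hcon
  have hdef (c : K) (δ : Γ) : DefPred L K fun p : K × K =>
      p.2 ∈ openBall v c (δ : WithBot Γ) ∧ E p.1 p.2 := by
    simp only [mem_openBall_coe]
    exact .and (DefVal.lt v) (DefPred.comp₂ hE)
  have finite (z : K) : {x ∈ openBall v a (γ : WithBot Γ) | E z x}.Finite := by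
    by_contra hinf
    obtain ⟨b, δ, hb⟩ := DefPred.exists_openBall_of_infinite v
      (DefPred.comp (t := fun x => (z, x)) (hdef a γ)) hinf
    obtain ⟨x, hx, hxE⟩ := hcon z b δ fun y hy => (hb y hy).1
    exact hxE (hb x hx).2
  obtain ⟨N, hN⟩ := DefPred.exists_ncard_le_of_finite v
    (R := fun z x => x ∈ openBall v a (γ : WithBot Γ) ∧ E z x) (hdef a γ)
  obtain ⟨b, δ, hsub, hdisj⟩ := exists_seq_disjoint_openBall (v := v) a γ
  have hit (i : ℕ) :
      ∀ᶠ z in generic v 0 κ, ∃ x, x ∈ openBall v (b i) (δ : WithBot Γ) ∧ E z x :=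
    DefPred.eventually_generic_exists
      (R := fun z x => x ∈ openBall v (b i) (δ : WithBot Γ) ∧ E z x)
      (hdef (b i) δ) (infinite_openBall (b i) δ)
      (fun z => (finite z).subset fun x hx => ⟨hsub i hx.1, hx.2.2⟩)
      (fun x hx => hg x (hsub i hx)) fun x hx z hz => ⟨hx, hEg x (hsub i hx) z hz⟩
  obtain ⟨z, hz⟩ := (eventually_all.2 fun i : Fin (N + 1) => hit i).exists
  choose x hx hxE using hz
  have hinj : Function.Injective x := fun i j hij => by
    by_contra hne
    exact (hdisj (Fin.val_ne_of_ne hne)).notMem_of_mem_left (hx i) (hij ▸ hx j)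
  have hrange : Set.range x ⊆ {x ∈ openBall v a (γ : WithBot Γ) | E z x} :=
    Set.range_subset_iff.2 fun i => ⟨hsub _ (hx i), hxE i⟩
  have hcard := Set.ncard_le_ncard hrange (finite z)
  rw [Set.ncard_range_of_injective hinj, Nat.card_fin] at hcard
  exact (hcard.trans (hN z (finite z))).not_gt (Nat.lt_succ_self N)

theorem DefPred.exists_openBall_uniform {R : K → K → Prop}
    (hR : DefPred L K fun p : K × K => R p.1 p.2) {a : K} {γ : Γ}
    (h : ∀ x ∈ openBall v a (γ : WithBot Γ), ∀ᶠ s in nearZero v, R x s) :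
    ∃ (b : K) (δ : Γ), openBall v b (δ : WithBot Γ) ⊆ openBall v a (γ : WithBot Γ) ∧
      ∀ x ∈ openBall v b (δ : WithBot Γ), ∀ y ∈ openBall v b (δ : WithBot Γ), y ≠ x →
        R x (y - x) := by
  let U (x d : K) : Prop := ∀ s, s ≠ 0 → v d ≤ v s → R x s
  have mono {x d e : K} (hd : U x d) (hde : v d ≤ v e) : U x e :=
    fun s hs hes => hd s hs (hde.trans hes)
  have hU : DefPred L K fun p : K × K => U p.1 p.2 :=
    .all (.imp (.not DefMap.eq) (.imp (DefVal.le v) (DefPred.comp₂ hR)))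
  have : IsTrans K fun x y => ∀ d, U x d → U y d := ⟨fun x y z h h' d hd => h' d (h d hd)⟩
  obtain ⟨b, δ, hsub, hb⟩ := DefPred.exists_openBall_of_total_preorder (L := L) (v := v)
    (R := fun x y => ∀ d, U x d → U y d)
    (.all (.imp (DefPred.comp₂ hU) (DefPred.comp₂ hU))) (fun x y => by
      by_contra! hcon
      obtain ⟨⟨d, hxd, hyd⟩, e, hye, hxe⟩ := hcon
      rcases le_total (v d) (v e) with hle | hle
      · exact hxe (mono hxd hle)
      · exact hyd (mono hye hle)) a γ
  obtain ⟨ε, hε⟩ := _root_.eventually_nearZero.1 (h b (hsub mem_openBall_self))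
  obtain ⟨d, hd⟩ := (Fact.out : Function.Surjective v) ε
  have hδ : openBall v b ((max δ ε : Γ) : WithBot Γ) ⊆ openBall v b (δ : WithBot Γ) :=
    openBall_subset mem_openBall_self (le_max_left _ _)
  refine ⟨b, max δ ε, hδ.trans hsub, fun x hx y hy hne => ?_⟩
  refine hb b mem_openBall_self x (hδ hx) d (fun s hs hds => hε s hs (hd ▸ hds)) _
    (sub_ne_zero.2 hne) ?_
  rw [hd]
  exact (WithTop.coe_le_coe.2 (le_max_right δ ε)).trans (lt_v_sub_of_mem_openBall hy hx).le

end Uniformity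

section Slope

open Filter

section OrderedGroup

variable {Γ : Type w'} [AddCommGroup Γ] [LinearOrder Γ] [IsOrderedAddMonoid Γ]

theorem nsmul_top_of_ne_zero {n : ℕ} (hn : n ≠ 0) : n • (⊤ : WithTop Γ) = ⊤ := by
  obtain ⟨k, rfl⟩ := Nat.exists_eq_succ_of_ne_zero hn
  rw [succ_nsmul, add_top]

theorem nsmul_withTop_injective {n : ℕ} (hn : n ≠ 0) :
    Function.Injective fun x : WithTop Γ => n • x := by
  intro x y h
  cases x <;> cases y
  · rfl
  · simp [nsmul_top_of_ne_zero hn, ← WithTop.coe_nsmul] at h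
  · simp [nsmul_top_of_ne_zero hn, ← WithTop.coe_nsmul] at h
  · simpa [← WithTop.coe_nsmul, WithTop.coe_inj, hn] using h

theorem eq_of_eventually_nsmul_add_eq [Nontrivial Γ] {a b : Γ} {m n : ℕ}
    (h : ∀ᶠ ε : Γ in atTop, a + m • ε = b + n • ε) : m = n := by
  obtain ⟨ε, hε⟩ := eventually_atTop.1 h
  obtain ⟨ε', hlt⟩ := exists_gt ε
  refine (nsmul_left_strictMono (sub_pos.2 hlt)).injective ?_
  have heq : (a + m • ε') - (a + m • ε) = (b + n • ε') - (b + n • ε) := by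
    rw [hε ε le_rfl, hε ε' hlt.le]
  simpa only [add_sub_add_left_eq_sub, ← nsmul_sub] using heq

theorem EventuallyQLinear.exists_nat_of_strictMonoOn [Nontrivial Γ] {g : Γ → Γ}
    (hg : EventuallyQLinear g) {γ : Γ} (hmono : StrictMonoOn g (Set.Ioi γ)) :
    ∃ (m n : ℕ) (α : Γ), m ≠ 0 ∧ n ≠ 0 ∧ ∀ᶠ ε in atTop, n • g ε = n • α + m • ε := by
  obtain ⟨δ, α, r, hr⟩ := hg
  have hpos : 0 < r.num := by
    obtain ⟨ε, hε⟩ := exists_gt (max γ δ)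
    obtain ⟨ε', hlt⟩ := exists_gt ε
    have hγ := (le_max_left γ δ).trans_lt hε
    have hδ := (le_max_right γ δ).trans_lt hε
    have hsmul : r.num • ε < r.num • ε' := by
      rw [← hr ε hδ, ← hr ε' (hδ.trans hlt)]
      exact nsmul_lt_nsmul_right r.den_nz (sub_lt_sub_right (hmono hγ (hγ.trans hlt) hlt) α)
    by_contra! hneg
    exact hsmul.not_ge (smul_le_smul_of_nonpos_left hlt.le hneg)
  refine ⟨r.num.toNat, r.den, α, by omega, r.den_nz, (eventually_gt_atTop δ).mono fun ε hε => ?_⟩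
  rw [← natCast_zsmul ε, Int.toNat_of_nonneg hpos.le, ← hr ε hε, nsmul_sub, add_sub_cancel]

end OrderedGroup

section Valued

variable {K : Type w} [Field K] {Γ : Type w'} [AddCommGroup Γ] [LinearOrder Γ]
  [IsOrderedAddMonoid Γ] {v : AddValuation K (WithTop Γ)}

theorem v_natCast_nonneg (n : ℕ) : 0 ≤ v (n : K) := by
  induction n with
  | zero => simp
  | succ n ih =>
    push_cast
    exact v.map_le_add ih v.map_one.ge

theorem v_pow_sub_one_ge {z : K} (hz : 0 ≤ v (z - 1)) (n : ℕ) : v (z - 1) ≤ v (z ^ n - 1) := by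
  have hz' : 0 ≤ v z := by simpa using v.map_le_add hz v.map_one.ge
  have hsum : 0 ≤ v (∑ i ∈ Finset.range n, z ^ i) :=
    v.map_le_sum fun i _ => (v.map_pow z i).symm ▸ nsmul_nonneg hz' i
  rw [← geom_sum_mul, v.map_mul]
  exact le_add_of_nonneg_left hsum

theorem v_pow_sub_one {z : K} {n : ℕ} (hz : v (n : K) < v (z - 1)) :
    v (z ^ n - 1) = v (n : K) + v (z - 1) := by
  have hz' : 0 ≤ v (z - 1) := (v_natCast_nonneg n).trans hz.le
  have hsum : ∑ i ∈ Finset.range n, z ^ i = (n : K) + ∑ i ∈ Finset.range n, (z ^ i - 1) := by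
    simp
  rw [← geom_sum_mul, v.map_mul, hsum, v.map_add_eq_of_lt_left
    (hz.trans_le (v.map_le_sum fun i _ => v_pow_sub_one_ge hz' i))]

/-- `f` preserves and reflects the `C`-relation on `B`: the combinatorial half of `IsCIsoOn`, which
unlike the latter passes to subsets. -/
def PreservesC (v : AddValuation K (WithTop Γ)) (f : K → K) (B : Set K) : Prop :=
  ∀ x ∈ B, ∀ y ∈ B, ∀ z ∈ B, CRel v x y z ↔ CRel v (f x) (f y) (f z)

theorem v_sub_lt_iff_cRel {x y z : K} : v (x - y) < v (x - z) ↔ CRel v y x z := by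
  rw [CRel, v.map_sub_swap y x, v.map_sub_swap y z]
  exact ⟨fun h => ⟨(v_sub_eq_of_lt h).symm, (v_sub_eq_of_lt h).trans_lt h⟩,
    fun h => h.1.trans_lt h.2⟩

namespace PreservesC

variable {f : K → K} {B : Set K}

theorem mono (h : PreservesC v f B) {B' : Set K} (hB : B' ⊆ B) : PreservesC v f B' :=
  fun x hx y hy z hz => h x (hB hx) y (hB hy) z (hB hz)

theorem lt_iff (h : PreservesC v f B) {x y z : K} (hx : x ∈ B) (hy : y ∈ B) (hz : z ∈ B) :
    v (x - y) < v (x - z) ↔ v (f x - f y) < v (f x - f z) := by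
  rw [v_sub_lt_iff_cRel, v_sub_lt_iff_cRel]
  exact h y hy x hx z hz

theorem add_lt_iff {a c s t : K} {γ : Γ} (h : PreservesC v f (openBall v a (γ : WithBot Γ)))
    (hc : c ∈ openBall v a (γ : WithBot Γ)) (hs : γ < v s) (ht : γ < v t) :
    v s < v t ↔ v (f (c + s) - f c) < v (f (c + t) - f c) := by
  have mem {s : K} (hs : γ < v s) : c + s ∈ openBall v a (γ : WithBot Γ) :=
    openBall_subset hc le_rfl (mem_openBall_coe.2 (by rwa [add_sub_cancel_left]))
  simpa only [v.map_sub_swap c, v.map_sub_swap (f c), add_sub_cancel_left]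
    using h.lt_iff hc (mem hs) (mem ht)

theorem exists_strictMonoOn [Fact (Function.Surjective v)] {a c : K} {γ : Γ}
    (h : PreservesC v f (openBall v a (γ : WithBot Γ))) (hc : c ∈ openBall v a (γ : WithBot Γ)) :
    ∃ g : Γ → Γ, StrictMonoOn g (Set.Ioi γ) ∧
      ∀ ε > γ, ∀ s, v s = (ε : WithTop Γ) → v (f (c + s) - f c) = g ε := by
  choose σ hσ using fun ε : Γ => (Fact.out : Function.Surjective v) ε
  have lt_v {ε : Γ} (hε : γ < ε) {s : K} (hs : v s = ε) : γ < v s :=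
    hs ▸ WithTop.coe_lt_coe.2 hε
  have value (ε : Γ) : ∃ η : Γ, γ < ε → ∀ s, v s = (ε : WithTop Γ) → v (f (c + s) - f c) = η := by
    by_cases hε : γ < ε
    · have htop : v (f (c + σ ε) - f c) < v (f (c + 0) - f c) :=
        (h.add_lt_iff hc (lt_v hε (hσ ε)) (by simp)).1 (by simp [hσ])
      obtain ⟨η, hη⟩ := WithTop.ne_top_iff_exists.1 htop.ne_top
      refine ⟨η, fun hε s hs => hη ▸ le_antisymm (not_lt.1 fun hlt => ?_) (not_lt.1 fun hlt => ?_)⟩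
      · exact ((h.add_lt_iff hc (lt_v hε (hσ ε)) (lt_v hε hs)).2 hlt).ne ((hσ ε).trans hs.symm)
      · exact ((h.add_lt_iff hc (lt_v hε hs) (lt_v hε (hσ ε))).2 hlt).ne (hs.trans (hσ ε).symm)
    · exact ⟨0, fun hε' => absurd hε' hε⟩
  choose g hg using value
  refine ⟨g, fun ε hε ε' hε' hlt => WithTop.coe_lt_coe.1 ?_, fun ε hε => hg ε hε⟩
  rw [← hg ε hε _ (hσ ε), ← hg ε' hε' _ (hσ ε'), ← h.add_lt_iff hc (lt_v hε (hσ ε))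
    (lt_v hε' (hσ ε')), hσ, hσ]
  exact WithTop.coe_lt_coe.2 hlt

end PreservesC

/-- `v (f y - f z) = α + (m / n) v (y - z)` for all `y, z ∈ B`, multiplied by `n`. -/
def HasValSlopeOn (v : AddValuation K (WithTop Γ)) (f : K → K) (B : Set K) (m n : ℕ) (α : Γ) :
    Prop :=
  ∀ y ∈ B, ∀ z ∈ B, n • v (f y - f z) = n • (α : WithTop Γ) + m • v (y - z)

end Valued

end Slope

section SlopeOne

open Filter

variable {K : Type w} [Field K] {Γ : Type w'} [AddCommGroup Γ] [LinearOrder Γ]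
  [IsOrderedAddMonoid Γ] {v : AddValuation K (WithTop Γ)}

theorem v_eq_zero_of_sub_one_pos {x : K} (hx : 0 < v (x - 1)) : v x = 0 := by
  rw [← sub_add_cancel x 1, v.map_add_eq_of_lt_right (by rwa [v.map_one]), v.map_one]

theorem v_natCast_add_v_sub_one_eq {z τ : K} {m n : ℕ} (hz : v (n : K) < v (z - 1))
    (hτ : v (m : K) < v (τ - 1)) (h : v (m : K) + v (τ - 1) < v (z ^ n / τ ^ m - 1)) :
    v (n : K) + v (z - 1) = v (m : K) + v (τ - 1) := by
  have hvτ : v τ = 0 := v_eq_zero_of_sub_one_pos ((v_natCast_nonneg m).trans_lt hτ)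
  have hτ₀ : τ ≠ 0 := ne_zero_of_v_eq_coe (γ := 0) hvτ
  have hmul : (z ^ n / τ ^ m - 1) * τ ^ m = z ^ n - τ ^ m := by
    rw [sub_one_mul, div_mul_cancel₀ _ (pow_ne_zero m hτ₀)]
  rw [← v_pow_sub_one hz, ← v_pow_sub_one hτ]
  rw [← v_pow_sub_one hτ, ← add_zero (v (z ^ n / τ ^ m - 1)), ← nsmul_zero m, ← hvτ, ← v.map_pow,
    ← v.map_mul, hmul, v.map_sub_swap (z ^ n)] at h
  exact v_sub_eq_of_lt h

namespace HasValSlopeOn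

variable {f : K → K} {B : Set K} {m n : ℕ} {α : Γ}

theorem v_eq (h : HasValSlopeOn v f B n n α) (hn : n ≠ 0) {y z : K} (hy : y ∈ B) (hz : z ∈ B) :
    v (f y - f z) = α + v (y - z) :=
  nsmul_withTop_injective hn ((h y hy z hz).trans (nsmul_add _ _ n).symm)

variable {a s : K} {γ : Γ}

theorem nsmul_v_add_sub (h : HasValSlopeOn v f (openBall v a (γ : WithBot Γ)) m n α)
    (hs : γ < v s) : n • v (f (a + s) - f a) = n • (α : WithTop Γ) + m • v s := by
  have := h (a + s) (mem_openBall_coe.2 (by rwa [add_sub_cancel_left])) a mem_openBall_self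
  rwa [add_sub_cancel_left] at this

theorem add_sub_ne_zero (h : HasValSlopeOn v f (openBall v a (γ : WithBot Γ)) m n α) (hn : n ≠ 0)
    (hs₀ : s ≠ 0) (hs : γ < v s) : f (a + s) - f a ≠ 0 := by
  intro hf
  have hslope := h.nsmul_v_add_sub hs
  obtain ⟨σ, hσ⟩ := exists_coe_eq_v (v := v) hs₀
  rw [hf, v.map_zero, nsmul_top_of_ne_zero hn, hσ] at hslope
  exact WithTop.coe_ne_top (a := n • α + m • σ) (by exact_mod_cast hslope.symm)

theorem v_pow_div_pow (h : HasValSlopeOn v f (openBall v a (γ : WithBot Γ)) m n α) (hs₀ : s ≠ 0)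
    (hs : γ < v s) : v ((f (a + s) - f a) ^ n / s ^ m) = (n • α : Γ) := by
  obtain ⟨σ, hσ⟩ := exists_coe_eq_v (v := v) hs₀
  have hmul : v ((f (a + s) - f a) ^ n / s ^ m) + v (s ^ m) = (n • α : Γ) + v (s ^ m) := by
    rw [← v.map_mul, div_mul_cancel₀ _ (pow_ne_zero m hs₀), v.map_pow, v.map_pow,
      h.nsmul_v_add_sub hs, WithTop.coe_nsmul]
  refine WithTop.add_right_cancel ?_ hmul
  rw [v.map_pow, hσ, ← WithTop.coe_nsmul]
  exact WithTop.coe_ne_top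

theorem nsmul_v_div_sub_one (h : HasValSlopeOn v f (openBall v a (γ : WithBot Γ)) m n α)
    (hn : n ≠ 0) {τ : K} (hs₀ : s ≠ 0) (hs : γ < v s) (hτs : γ < v (τ * s)) :
    n • v ((f (a + τ * s) - f a) / (f (a + s) - f a) - 1) = m • v (τ - 1) := by
  have mem {t : K} (ht : γ < v t) : a + t ∈ openBall v a (γ : WithBot Γ) :=
    mem_openBall_coe.2 (by rwa [add_sub_cancel_left])
  have hu := h.add_sub_ne_zero hn hs₀ hs
  have hmul : ((f (a + τ * s) - f a) / (f (a + s) - f a) - 1) * (f (a + s) - f a) =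
      f (a + τ * s) - f (a + s) := by
    rw [sub_mul, div_mul_cancel₀ _ hu]
    ring
  have hdiff : a + τ * s - (a + s) = (τ - 1) * s := by ring
  obtain ⟨η, hη⟩ := exists_coe_eq_v (v := v) hu
  have hfin : n • v (f (a + s) - f a) ≠ ⊤ := by
    rw [hη, ← WithTop.coe_nsmul]
    exact WithTop.coe_ne_top
  refine WithTop.add_right_cancel hfin ?_
  rw [← nsmul_add, ← v.map_mul, hmul, h _ (mem hτs) _ (mem hs), hdiff, v.map_mul, nsmul_add,
    h.nsmul_v_add_sub hs, add_left_comm]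

end HasValSlopeOn

variable {L : FirstOrder.Language.{u₁, u₂}} [L.Structure K] [UniformlyCMinimal L v]
  [Nontrivial Γ] [IsAlgClosed K] [Fact (Function.Surjective v)] [DefinableField L K]
  [DefinableValuation L v]

theorem DefMap.exists_openBall_v_sub_eq {f : K → K} (hf : DefMap L K f) (a : K) (γ : Γ) :
    ∃ (c b : K) (δ : Γ), c ∈ openBall v a (γ : WithBot Γ) ∧
      openBall v b (δ : WithBot Γ) ⊆ openBall v a (γ : WithBot Γ) ∧
      ∀ x ∈ openBall v b (δ : WithBot Γ), ∀ y ∈ openBall v b (δ : WithBot Γ),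
        v (f y - f x) = v (f (c + (y - x)) - f c) := by
  let R (x y : K) : Prop := ∀ᶠ s in nearZero v, v (f (x + s) - f x) ≤ v (f (y + s) - f y)
  have hR : DefPred L K fun p : K × K => R p.1 p.2 := DefPred.eventually_nearZero
    (R := fun (p : K × K) s => v (f (p.1 + s) - f p.1) ≤ v (f (p.2 + s) - f p.2)) (DefVal.le v)
  have : IsTrans K R := ⟨fun x y z hxy hyz => by filter_upwards [hxy, hyz] with s using le_trans⟩
  have total (x y : K) : R x y ∨ R y x := by
    have hdef : DefPred L K fun s => v (f (x + s) - f x) ≤ v (f (y + s) - f y) := DefVal.le v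
    refine (eventuallyConst_pred.1 (hdef.eventuallyConst_nearZero v)).imp_right fun h => ?_
    exact h.mono fun s hs => (not_le.1 hs).le
  obtain ⟨c, δ, hsub, hc⟩ :=
    DefPred.exists_openBall_of_total_preorder (v := v) hR total a γ
  obtain ⟨b, δ', hsub', hb⟩ := DefPred.exists_openBall_uniform (L := L) (v := v)
    (R := fun x s => v (f (x + s) - f x) = v (f (c + s) - f c)) (DefVal.eq v)
    (a := c) (γ := δ) fun x hx => by
      filter_upwards [hc x hx c mem_openBall_self, hc c mem_openBall_self x hx] with s
        using le_antisymm
  refine ⟨c, b, δ', hsub mem_openBall_self, hsub'.trans hsub, fun x hx y hy => ?_⟩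
  rcases eq_or_ne y x with rfl | hne
  · simp
  · simpa only [add_sub_cancel] using hb x hx y hy hne

variable [QLinearValueGroup L v]

theorem PreservesC.exists_hasValSlopeOn {f : K → K} (hf : DefMap L K f) {a : K} {γ : Γ}
    (hC : PreservesC v f (openBall v a (γ : WithBot Γ))) :
    ∃ (b : K) (δ : Γ) (m n : ℕ) (α : Γ), m ≠ 0 ∧ n ≠ 0 ∧
      openBall v b (δ : WithBot Γ) ⊆ openBall v a (γ : WithBot Γ) ∧
      HasValSlopeOn v f (openBall v b (δ : WithBot Γ)) m n α := by
  obtain ⟨c, b, δ, hc, hsub, hb⟩ := hf.exists_openBall_v_sub_eq (v := v) a γ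
  obtain ⟨g, hmono, hg⟩ := hC.exists_strictMonoOn hc
  have hdef : DefVal L v fun s => v (f (c + s) - f c) := by fun_prop
  obtain ⟨m, n, α, hm, hn, hlin⟩ := (hdef.eventuallyQLinear (g := g)
    ((eventually_gt_atTop γ).mono hg)).exists_nat_of_strictMonoOn hmono
  obtain ⟨ρ, hρ⟩ := eventually_atTop.1 (hlin.and (eventually_gt_atTop γ))
  have hδ : openBall v b ((max δ ρ : Γ) : WithBot Γ) ⊆ openBall v b (δ : WithBot Γ) :=
    openBall_subset mem_openBall_self (le_max_left _ _)
  refine ⟨b, max δ ρ, m, n, α, hm, hn, hδ.trans hsub, fun y hy z hz => ?_⟩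
  rcases eq_or_ne y z with rfl | hne
  · simp [nsmul_top_of_ne_zero hm, nsmul_top_of_ne_zero hn]
  obtain ⟨ε, hε⟩ := exists_coe_eq_v (v := v) (sub_ne_zero.2 hne)
  have hlt : max δ ρ < ε := WithTop.coe_lt_coe.1 (hε ▸ lt_v_sub_of_mem_openBall hy hz)
  obtain ⟨heq, hγ⟩ := hρ ε ((le_max_right δ ρ).trans hlt.le)
  rw [hb z (hδ hz) y (hδ hy), hg ε hγ _ hε, hε]
  exact_mod_cast heq

theorem DefMap.eventually_lt_v_div_sub_one {q : K → K} (hq : DefMap L K q) {β : Γ}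
    (hβ : ∀ᶠ s in nearZero v, v (q s) = β) {τ : K} (hτ : τ ≠ 0) (σ : Γ) :
    ∀ᶠ s in nearZero v, σ < v (q (τ * s) / q s - 1) := by
  obtain ⟨l, hl⟩ := hq.exists_eventually_lt_v_sub (hβ.mono fun s hs => hs.ge) (β + σ)
  filter_upwards [hl, (tendsto_mul_nearZero hτ).eventually hl, hβ] with s hs hτs hqs
  have hlt : ((β + σ : Γ) : WithTop Γ) < v (q (τ * s) - q s) :=
    lt_v_sub_of_lt_of_lt hτs (v.map_sub_swap l _ ▸ hs)
  rw [← div_mul_cancel₀ (q (τ * s)) (ne_zero_of_v_eq_coe hqs), ← sub_one_mul, v.map_mul, hqs,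
    WithTop.coe_add, add_comm] at hlt
  exact lt_of_add_lt_add_right hlt

/-- Near `0` the definable map `s ↦ (f (a + s) - f a) ^ n / s ^ m` has constant value, hence is
asymptotically invariant under `s ↦ τ s`. Thus `z ^ n` is close to `τ ^ m`, where `z - 1` has value
`(m / n) v (τ - 1)`. -/
theorem HasValSlopeOn.nsmul_v_add {f : K → K} (hf : DefMap L K f) {a : K} {γ : Γ} {m n : ℕ} {α : Γ}
    (h : HasValSlopeOn v f (openBall v a (γ : WithBot Γ)) m n α) (hm : m ≠ 0) (hn : n ≠ 0)
    {A B ε : Γ} (hA : v (n : K) = A) (hB : v (m : K) = B) (hAε : n • A < ε) (hBε : B < ε) :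
    n • A + m • ε = n • B + n • ε := by
  have hε : 0 < ε := (WithTop.coe_le_coe.1 (hB ▸ v_natCast_nonneg m)).trans_lt hBε
  obtain ⟨e, he⟩ := (Fact.out : Function.Surjective v) ε
  obtain ⟨τ, hτ⟩ : ∃ τ, v (τ - 1) = ε := ⟨1 + e, by rwa [add_sub_cancel_left]⟩
  have hτ₀ : τ ≠ 0 := ne_zero_of_v_eq_coe (γ := 0)
    (v_eq_zero_of_sub_one_pos (hτ ▸ WithTop.coe_lt_coe.2 hε))
  have hq : DefMap L K fun s => (f (a + s) - f a) ^ n / s ^ m := by fun_prop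
  have hsmall := eventually_nearZero_lt (v := v) γ
  obtain ⟨s, hclose, hs₀, hs, hτs⟩ := ((hq.eventually_lt_v_div_sub_one (β := n • α)
    ((eventually_nearZero_ne.and hsmall).mono fun s hs => h.v_pow_div_pow hs.1 hs.2)
    hτ₀ (B + ε)).and (eventually_nearZero_ne.and (hsmall.and
    ((tendsto_mul_nearZero hτ₀).eventually hsmall)))).exists
  have hz := h.nsmul_v_div_sub_one hn hs₀ hs hτs
  have hu := h.add_sub_ne_zero hn hs₀ hs
  set z := (f (a + τ * s) - f a) / (f (a + s) - f a) with hz_def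
  have hquot : (f (a + τ * s) - f a) ^ n / (τ * s) ^ m / ((f (a + s) - f a) ^ n / s ^ m) =
      z ^ n / τ ^ m := by
    rw [hz_def, div_pow, mul_pow]
    field_simp
  have hAz : v (n : K) < v (z - 1) := by
    refine lt_of_nsmul_lt_nsmul_right n ?_
    rw [hz, hτ, hA, ← WithTop.coe_nsmul, ← WithTop.coe_nsmul, WithTop.coe_lt_coe]
    exact hAε.trans_le (le_self_nsmul hε.le hm)
  have hval := v_natCast_add_v_sub_one_eq hAz (by rwa [hB, hτ, WithTop.coe_lt_coe])
    (by rwa [hquot, WithTop.coe_add, ← hB, ← hτ] at hclose)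
  have hn_val := congrArg (n • ·) hval
  simp only [nsmul_add, hz, hA, hB, hτ] at hn_val
  exact_mod_cast hn_val

theorem HasValSlopeOn.eq [CharZero K] {f : K → K} (hf : DefMap L K f) {a : K} {γ : Γ} {m n : ℕ}
    {α : Γ} (h : HasValSlopeOn v f (openBall v a (γ : WithBot Γ)) m n α) (hm : m ≠ 0)
    (hn : n ≠ 0) : m = n := by
  obtain ⟨A, hA⟩ := exists_coe_eq_v (v := v) (Nat.cast_ne_zero (R := K).2 hn)
  obtain ⟨B, hB⟩ := exists_coe_eq_v (v := v) (Nat.cast_ne_zero (R := K).2 hm)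
  refine eq_of_eventually_nsmul_add_eq (a := n • A) (b := n • B) ?_
  filter_upwards [eventually_gt_atTop (n • A), eventually_gt_atTop B] with ε hAε hBε
    using h.nsmul_v_add hf hm hn hA hB hAε hBε

theorem PreservesC.exists_v_sub_eq [CharZero K] {f : K → K} (hf : DefMap L K f) {a : K} {γ : Γ}
    (hC : PreservesC v f (openBall v a (γ : WithBot Γ))) :
    ∃ (b : K) (δ α : Γ), openBall v b (δ : WithBot Γ) ⊆ openBall v a (γ : WithBot Γ) ∧
      ∀ y ∈ openBall v b (δ : WithBot Γ), ∀ z ∈ openBall v b (δ : WithBot Γ),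
        v (f y - f z) = α + v (y - z) := by
  obtain ⟨b, δ, m, n, α, hm, hn, hsub, h⟩ := hC.exists_hasValSlopeOn hf
  obtain rfl : m = n := h.eq hf hm hn
  exact ⟨b, δ, α, hsub, fun y hy z hz => h.v_eq hn hy hz⟩

end SlopeOne

section AlmostAffine

open Filter

variable {K : Type w} [Field K] {Γ : Type w'} [AddCommGroup Γ] [LinearOrder Γ]
  [IsOrderedAddMonoid Γ] {v : AddValuation K (WithTop Γ)}

theorem rv_zero : rv v (0 : K) = 0 := dif_pos rfl

theorem rv_mul (x y : K) : rv v (x * y) = rv v x * rv v y := by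
  rcases eq_or_ne x 0 with rfl | hx
  · simp [rv_zero]
  rcases eq_or_ne y 0 with rfl | hy
  · simp [rv_zero]
  rw [rv, rv, rv, dif_neg hx, dif_neg hy, dif_neg (mul_ne_zero hx hy), Units.mk0_mul, map_mul,
    WithZero.coe_mul]

theorem ne_zero_of_v_lt {x : K} {γ : WithTop Γ} (h : v x < γ) : x ≠ 0 :=
  v.ne_top_iff.1 h.ne_top

theorem ne_zero_of_v_lt_v_sub {x d : K} (h : v d < v (x - d)) : x ≠ 0 := by
  rintro rfl
  rw [zero_sub, v.map_neg] at h
  exact h.false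

theorem rv_eq_of_v_lt_v_sub {x d : K} (h : v d < v (x - d)) : rv v x = rv v d := by
  have hx := ne_zero_of_v_lt_v_sub h
  have hd := ne_zero_of_v_lt h
  rw [rv, rv, dif_neg hx, dif_neg hd, WithZero.coe_inj, eq_comm]
  refine QuotientGroup.eq.2 (show 0 < v (d⁻¹ * x - 1) from ?_)
  have hmul : d * (d⁻¹ * x - 1) = x - d := by rw [mul_sub, mul_inv_cancel_left₀ hd, mul_one]
  rw [← hmul, v.map_mul] at h
  exact lt_of_add_lt_add_left (a := v d) (by rwa [add_zero])

theorem IsOpenBall.exists_openBall_subset {B : Set K} (hB : IsOpenBall v B) {x : K} (hx : x ∈ B) :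
    ∃ γ : Γ, openBall v x (γ : WithBot Γ) ⊆ B := by
  obtain ⟨a, ρ, rfl⟩ := hB
  cases ρ with
  | bot => exact ⟨0, fun y _ => by simp [openBall]⟩
  | coe γ => exact ⟨γ, openBall_subset hx le_rfl⟩

theorem IsOpenBall.mem_of_lt {B : Set K} (hB : IsOpenBall v B) {x y z : K} (hx : x ∈ B)
    (hy : y ∈ B) (h : v (y - x) < v (z - x)) : z ∈ B := by
  obtain ⟨a, ρ, rfl⟩ := hB
  cases ρ with
  | bot => simp [openBall]
  | coe γ =>
    exact openBall_subset hx le_rfl (mem_openBall_coe.2 ((lt_v_sub_of_mem_openBall hy hx).trans h))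

theorem IsCIsoOn.isOpenBall_image_openBall {f : K → K} {B : Set K} (h : IsCIsoOn v f B) {x y : K}
    {ρ : Γ} (hx : x ∈ B) (hy : y ∈ B) (hxy : v (x - y) = ρ)
    (hsub : openBall v x (ρ : WithBot Γ) ⊆ B) :
    IsOpenBall v (f '' openBall v x (ρ : WithBot Γ)) := by
  have hC : PreservesC v f B := h.2
  have hne : v (f x - f y) < v (f x - f x) :=
    (hC.lt_iff hx hy hx).1 (by simp [hxy])
  obtain ⟨ε, hε⟩ := exists_coe_eq_v (v := v) (ne_zero_of_v_lt hne)
  have mem_iff {z : K} (hz : z ∈ B) :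
      z ∈ openBall v x (ρ : WithBot Γ) ↔ f z ∈ openBall v (f x) (ε : WithBot Γ) := by
    rw [mem_openBall_coe, mem_openBall_coe, ← hxy, ← hε, v.map_sub_swap z, v.map_sub_swap (f z)]
    exact hC.lt_iff hx hy hz
  refine ⟨f x, ε, Set.Subset.antisymm (Set.image_subset_iff.2 fun z hz =>
    (mem_iff (hsub hz)).1 hz) fun t ht => ?_⟩
  obtain ⟨z, hz, rfl⟩ := h.1.mem_of_lt (z := t) (Set.mem_image_of_mem f hx)
    (Set.mem_image_of_mem f hy) (by rw [v.map_sub_swap, hε]; exact mem_openBall_coe.1 ht)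
  exact ⟨z, (mem_iff hz).2 ht, rfl⟩

/-- On `B` all difference quotients of `f` have the same leading term as `d`, so that `f` is there
approximated by the affine maps of slope `d`. -/
def IsAlmostAffineOn (v : AddValuation K (WithTop Γ)) (f : K → K) (d : K) (B : Set K) : Prop :=
  ∀ y ∈ B, ∀ z ∈ B, y ≠ z → v d < v ((f y - f z) / (y - z) - d)

namespace IsAlmostAffineOn

variable {f : K → K} {d : K} {B : Set K}

theorem mono (h : IsAlmostAffineOn v f d B) {B' : Set K} (hB : B' ⊆ B) :
    IsAlmostAffineOn v f d B' :=
  fun y hy z hz => h y (hB hy) z (hB hz)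

theorem injOn (h : IsAlmostAffineOn v f d B) : Set.InjOn f B := by
  intro y hy z hz hf
  by_contra hne
  exact ne_zero_of_v_lt_v_sub (h y hy z hz hne) (by rw [hf, sub_self, zero_div])

theorem rv_sub (h : IsAlmostAffineOn v f d B) {y z : K} (hy : y ∈ B) (hz : z ∈ B) :
    rv v (f y - f z) = rv v (y - z) * rv v d := by
  rcases eq_or_ne y z with rfl | hne
  · rw [sub_self, sub_self, rv_zero, zero_mul]
  · rw [← rv_eq_of_v_lt_v_sub (h y hy z hz hne), ← rv_mul, mul_div_cancel₀ _ (sub_ne_zero.2 hne)]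

theorem eventually_nearZero [Nontrivial Γ] {a x : K} {γ : Γ}
    (h : IsAlmostAffineOn v f d (openBall v a (γ : WithBot Γ)))
    (hx : x ∈ openBall v a (γ : WithBot Γ)) :
    ∀ᶠ s in nearZero v, v d < v ((f (x + s) - f x) / s - d) := by
  filter_upwards [eventually_nearZero_ne, eventually_nearZero_lt γ] with s hs₀ hs
  have hmem : x + s ∈ openBall v a (γ : WithBot Γ) :=
    openBall_subset hx le_rfl (mem_openBall_coe.2 (by rwa [add_sub_cancel_left]))
  simpa only [add_sub_cancel_left] using h _ hmem x hx (add_ne_left.2 hs₀)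

end IsAlmostAffineOn

theorem hasValDerivOn_of_eventually {f : K → K} {x l : K} (B : Set K)
    (h : ∀ σ : Γ, ∀ᶠ s in nearZero v, σ < v ((f (x + s) - f x) / s - l)) :
    HasValDerivOn v f B x l := by
  intro σ
  obtain ⟨δ, hδ⟩ := eventually_nearZero.1 (h σ)
  refine ⟨δ, fun y _ hne hlt => ?_⟩
  simpa only [add_sub_cancel] using hδ (y - x) (sub_ne_zero.2 hne) hlt.le

variable {L : FirstOrder.Language.{u₁, u₂}} [L.Structure K] [UniformlyCMinimal L v]
  [Nontrivial Γ] [IsAlgClosed K] [Fact (Function.Surjective v)] [DefinableField L K]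
  [DefinableValuation L v] [QLinearValueGroup L v]

/-- The quotients `(f (x + s) - f x) / s` all have value `α`; for `s` near `0` they lie in one
residue class `{t | α < v (t - z)}`, and `E z x` says that this is the class of `z`. -/
theorem DefMap.exists_isAlmostAffineOn {f : K → K} (hf : DefMap L K f) {a : K} {γ α : Γ}
    (h : ∀ y ∈ openBall v a (γ : WithBot Γ), ∀ z ∈ openBall v a (γ : WithBot Γ),
      v (f y - f z) = α + v (y - z)) :
    ∃ (b : K) (δ : Γ) (d : K), openBall v b (δ : WithBot Γ) ⊆ openBall v a (γ : WithBot Γ) ∧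
      IsAlmostAffineOn v f d (openBall v b (δ : WithBot Γ)) := by
  let E (z x : K) : Prop := ∀ᶠ s in nearZero v, α < v ((f (x + s) - f x) / s - z)
  have hE : DefPred L K fun p : K × K => E p.1 p.2 := DefPred.eventually_nearZero
    (R := fun (p : K × K) s => α < v ((f (p.2 + s) - f p.2) / s - p.1)) (DefVal.lt v)
  have hquot {y z : K} (hy : y ∈ openBall v a (γ : WithBot Γ))
      (hz : z ∈ openBall v a (γ : WithBot Γ)) (hne : y ≠ z) : v ((f y - f z) / (y - z)) = α := by
    obtain ⟨ε, hε⟩ := exists_coe_eq_v (v := v) (sub_ne_zero.2 hne)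
    refine WithTop.add_right_cancel (z := v (y - z)) (hε ▸ WithTop.coe_ne_top) ?_
    rw [← v.map_mul, div_mul_cancel₀ _ (sub_ne_zero.2 hne), h y hy z hz]
  have residue (x : K) (hx : x ∈ openBall v a (γ : WithBot Γ)) : ∃ t, α ≤ v t ∧ E t x := by
    have hα : ∀ᶠ s in nearZero v, α ≤ v ((f (x + s) - f x) / s) := by
      filter_upwards [eventually_nearZero_ne, eventually_nearZero_lt γ] with s hs₀ hs
      have hmem : x + s ∈ openBall v a (γ : WithBot Γ) :=
        openBall_subset hx le_rfl (mem_openBall_coe.2 (by rwa [add_sub_cancel_left]))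
      simpa only [add_sub_cancel_left] using (hquot hmem hx (add_ne_left.2 hs₀)).ge
    obtain ⟨t, ht⟩ := DefMap.exists_eventually_lt_v_sub (L := L)
      (h := fun s => (f (x + s) - f x) / s) (by fun_prop) hα α
    obtain ⟨s, hs, hst⟩ := (hα.and ht).exists
    exact ⟨t, by simpa using v.map_le_sub hs hst.le, ht⟩
  choose! g hg hgE using residue
  obtain ⟨d, b, δ, hsub, hd⟩ := DefPred.exists_openBall_forall_of_residue hE hg
    fun x hx z hz => (hgE x hx).mono fun s hs => lt_v_sub_of_lt_of_lt hs hz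
  obtain ⟨b', δ', hsub', hb'⟩ := DefPred.exists_openBall_uniform (L := L) (v := v)
    (R := fun x s => α < v ((f (x + s) - f x) / s - d)) (DefVal.lt v) hd
  refine ⟨b', δ', d, hsub'.trans hsub, fun y hy z hz hne => ?_⟩
  have hlt := hb' z hz y hy hne
  rw [add_sub_cancel] at hlt
  have hα := hquot (hsub (hsub' hy)) (hsub (hsub' hz)) hne
  rwa [v.map_eq_of_lt_sub (by rwa [hα, v.map_sub_swap]), hα]

namespace IsAlmostAffineOn

variable {f : K → K} {d x : K} {γ : Γ}

theorem exists_hasValDerivOn {a : K} (h : IsAlmostAffineOn v f d (openBall v a (γ : WithBot Γ)))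
    (hf : DefMap L K f) (hcomplete : IsDefinablyComplete v L)
    (hx : x ∈ openBall v a (γ : WithBot Γ)) :
    ∃ l, HasValDerivOn v f (openBall v a (γ : WithBot Γ)) x l ∧ v d < v (l - d) := by
  have hquot := h.eventually_nearZero hx
  obtain ⟨s₀, hs₀⟩ := hquot.exists
  obtain ⟨β, hβ⟩ := exists_coe_eq_v (v := v) (ne_zero_of_v_lt hs₀)
  obtain ⟨l, hl⟩ := DefMap.exists_limit_nearZero (h := fun s => (f (x + s) - f x) / s)
    (by fun_prop) hcomplete (β := β) (hquot.mono fun s hs => hβ ▸ (v.map_eq_of_lt_sub hs).ge)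
  obtain ⟨s, hs, hsl⟩ := (hquot.and (hl β)).exists
  rw [v.map_sub_swap, ← hβ] at hsl
  exact ⟨l, hasValDerivOn_of_eventually _ hl, lt_v_sub_of_lt_of_lt hsl hs⟩

theorem exists_hasJacobianProperty (h : IsAlmostAffineOn v f d (openBall v x (γ : WithBot Γ)))
    (hf : DefMap L K f) (hcomplete : IsDefinablyComplete v L) {B : Set K} (hB : IsOpenBall v B)
    (hx : x ∈ B) (hiso : IsCIsoOn v f B) :
    ∃ ρ, γ ≤ ρ ∧ HasJacobianProperty v f (openBall v x (ρ : WithBot Γ)) := by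
  obtain ⟨γ', hγ'⟩ := hB.exists_openBall_subset hx
  obtain ⟨ρ, hρ⟩ := exists_gt (max γ γ')
  have hγρ : γ ≤ ρ := (le_max_left _ _).trans hρ.le
  have hρB : openBall v x (ρ : WithBot Γ) ⊆ B :=
    (openBall_subset mem_openBall_self ((le_max_right _ _).trans hρ.le)).trans hγ'
  obtain ⟨s, hs⟩ := (Fact.out : Function.Surjective v) ρ
  have hy : x - s ∈ B := hγ' (mem_openBall_coe.2 (by
    rw [sub_sub_cancel_left, v.map_neg, hs]
    exact WithTop.coe_lt_coe.2 ((le_max_right _ _).trans_lt hρ)))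
  have hρd := h.mono (openBall_subset mem_openBall_self hγρ)
  choose! f' hf' hrv using fun y (hy : y ∈ openBall v x (ρ : WithBot Γ)) =>
    hρd.exists_hasValDerivOn hf hcomplete hy
  exact ⟨ρ, hγρ, hρd.injOn, hiso.isOpenBall_image_openBall hx hy (by rwa [sub_sub_cancel]) hρB,
    f', fun y hy => ⟨hf' y hy, ne_zero_of_v_lt_v_sub (hrv y hy)⟩, rv v d,
    fun y hy => rv_eq_of_v_lt_v_sub (hrv y hy), fun y hy z hz => hρd.rv_sub hy hz⟩

end IsAlmostAffineOn

end AlmostAffine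

section Congruence

variable {K : Type w} [Field K] {Γ : Type w'} [AddCommGroup Γ] [LinearOrder Γ]
  [IsOrderedAddMonoid Γ] {v : AddValuation K (WithTop Γ)} {f g : K → K} {B X : Set K}

theorem IsCIsoOn.congr (h : IsCIsoOn v f B) (hfg : Set.EqOn f g B) : IsCIsoOn v g B := by
  refine ⟨hfg.image_eq ▸ h.1, fun x hx y hy z hz => ?_⟩
  rw [← hfg hx, ← hfg hy, ← hfg hz]
  exact h.2 x hx y hy z hz

theorem IsLocalCIsoOn.congr (h : IsLocalCIsoOn v f X) (hfg : Set.EqOn f g X) :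
    IsLocalCIsoOn v g X := fun x hx =>
  let ⟨B, hB, hxB, hBX, hiso⟩ := h x hx
  ⟨B, hB, hxB, hBX, hiso.congr (hfg.mono hBX)⟩

theorem HasValDerivOn.congr {x d : K} (h : HasValDerivOn v f B x d) (hfg : Set.EqOn f g B)
    (hx : x ∈ B) : HasValDerivOn v g B x d := by
  intro γ
  obtain ⟨δ, hδ⟩ := h γ
  exact ⟨δ, fun y hy => by simpa only [← hfg hy, ← hfg hx] using hδ y hy⟩

theorem HasJacobianProperty.congr (h : HasJacobianProperty v f B) (hfg : Set.EqOn f g B) :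
    HasJacobianProperty v g B := by
  obtain ⟨hinj, himage, f', hf', c, hc, hrv⟩ := h
  refine ⟨hinj.congr hfg, hfg.image_eq ▸ himage, f',
    fun x hx => ⟨(hf' x hx).1.congr hfg hx, (hf' x hx).2⟩, c, hc, fun x hx y hy => ?_⟩
  rw [← hfg hx, ← hfg hy]
  exact hrv x hx y hy

theorem HasLocallyJacobianProperty.congr (h : HasLocallyJacobianProperty v f X)
    (hfg : Set.EqOn f g X) : HasLocallyJacobianProperty v g X := fun x hx =>
  let ⟨B, hB, hxB, hBX, hJ⟩ := h x hx
  ⟨B, hB, hxB, hBX, hJ.congr (hfg.mono hBX)⟩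

end Congruence

section AlmostAffineLocus

variable {K : Type w} [Field K] {Γ : Type w'} [AddCommGroup Γ] [LinearOrder Γ]
  [IsOrderedAddMonoid Γ] {v : AddValuation K (WithTop Γ)} {f : K → K} {X : Set K}

/-- The points of `X` around which `f` is almost affine; the points of `X` outside this set are the
exceptional ones of the main theorem. -/
def almostAffineLocus (v : AddValuation K (WithTop Γ)) (f : K → K) (X : Set K) : Set K :=
  {x | ∃ γ : Γ, openBall v x (γ : WithBot Γ) ⊆ X ∧
    ∃ d, IsAlmostAffineOn v f d (openBall v x (γ : WithBot Γ))}

theorem openBall_subset_almostAffineLocus {d x : K} {γ : Γ}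
    (hX : openBall v x (γ : WithBot Γ) ⊆ X)
    (h : IsAlmostAffineOn v f d (openBall v x (γ : WithBot Γ))) :
    openBall v x (γ : WithBot Γ) ⊆ almostAffineLocus v f X := fun _ hy =>
  ⟨γ, (openBall_subset hy le_rfl).trans hX, d, h.mono (openBall_subset hy le_rfl)⟩

theorem almostAffineLocus_subset : almostAffineLocus v f X ⊆ X :=
  fun _ ⟨_, hX, _⟩ => hX mem_openBall_self

theorem mem_almostAffineLocus_iff [Fact (Function.Surjective v)] {x : K} :
    x ∈ almostAffineLocus v f X ↔ ∃ c d, c ≠ 0 ∧ ∀ y, v c < v (y - x) → y ∈ X ∧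
      ∀ z, v c < v (z - x) → y ≠ z → v d < v ((f y - f z) / (y - z) - d) := by
  constructor
  · rintro ⟨γ, hX, d, h⟩
    obtain ⟨c, hc⟩ := (Fact.out : Function.Surjective v) γ
    simp only [IsAlmostAffineOn, mem_openBall_coe, ← hc] at h
    exact ⟨c, d, ne_zero_of_v_eq_coe hc, fun y hy =>
      ⟨hX (mem_openBall_coe.2 (hc ▸ hy)), h y hy⟩⟩
  · rintro ⟨c, d, hc₀, h⟩
    obtain ⟨γ, hγ⟩ := exists_coe_eq_v (v := v) hc₀
    simp only [hγ, ← mem_openBall_coe] at h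
    exact ⟨γ, fun y hy => (h y hy).1, d, fun y hy => (h y hy).2⟩

variable {L : FirstOrder.Language.{u₁, u₂}} [L.Structure K]

theorem DefPred.mem_almostAffineLocus [Fact (Function.Surjective v)] [DefinableField L K]
    [DefinableValuation L v] {α : Type w} [FinitePower K α] {Y : Set (α × K)}
    (hY : DefPred L K fun p => p ∈ Y) {g : α × K → K} (hg : DefMap L K g) :
    DefPred L K fun p : α × K =>
      p.2 ∈ almostAffineLocus v (fun x => g (p.1, x)) {x | (p.1, x) ∈ Y} := by
  simp only [mem_almostAffineLocus_iff]
  exact .ex (.ex (.and (.not DefMap.eq) (.all (.imp (DefVal.lt v) (.and hY.comp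
    (.all (.imp (DefVal.lt v) (.imp (.not DefMap.eq) (DefVal.lt v)))))))))

variable [UniformlyCMinimal L v] [Nontrivial Γ] [IsAlgClosed K] [Fact (Function.Surjective v)]
  [DefinableField L K] [DefinableValuation L v] [QLinearValueGroup L v]

theorem IsLocalCIsoOn.finite_sdiff_almostAffineLocus [CharZero K] (hiso : IsLocalCIsoOn v f X)
    (hf : DefMap L K f) (hX : DefPred L K fun x => x ∈ X \ almostAffineLocus v f X) :
    (X \ almostAffineLocus v f X).Finite := by
  by_contra hinf
  obtain ⟨x, γ, hγ⟩ := DefPred.exists_openBall_of_infinite v hX hinf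
  obtain ⟨B, hB, hxB, -, hisoB⟩ := hiso x (hγ x mem_openBall_self).1
  obtain ⟨γ', hγ'⟩ := hB.exists_openBall_subset hxB
  have hsub : openBall v x ((max γ γ' : Γ) : WithBot Γ) ⊆ X \ almostAffineLocus v f X :=
    (openBall_subset mem_openBall_self (le_max_left _ _)).trans hγ
  have hC : PreservesC v f (openBall v x ((max γ γ' : Γ) : WithBot Γ)) :=
    PreservesC.mono hisoB.2 ((openBall_subset mem_openBall_self (le_max_right _ _)).trans hγ')
  obtain ⟨b, δ, α, hb, hslope⟩ := hC.exists_v_sub_eq hf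
  obtain ⟨b', δ', d, hb', hd⟩ := DefMap.exists_isAlmostAffineOn hf hslope
  have hbad := (hb'.trans hb).trans hsub
  exact (hbad mem_openBall_self).2 (openBall_subset_almostAffineLocus
    (hbad.trans Set.sdiff_subset) hd mem_openBall_self)

theorem IsLocalCIsoOn.hasLocallyJacobianProperty (hiso : IsLocalCIsoOn v f X)
    (hf : DefMap L K f) (hcomplete : IsDefinablyComplete v L) :
    HasLocallyJacobianProperty v f (almostAffineLocus v f X) := by
  rintro x hx
  obtain ⟨B, hB, hxB, -, hisoB⟩ := hiso x (almostAffineLocus_subset hx)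
  obtain ⟨γ, hX, d, hd⟩ := hx
  obtain ⟨ρ, hρ, hJ⟩ := hd.exists_hasJacobianProperty hf hcomplete hB hxB hisoB
  exact ⟨_, ⟨x, ρ, rfl⟩, mem_openBall_self, (openBall_subset mem_openBall_self hρ).trans
    (openBall_subset_almostAffineLocus hX hd), hJ⟩

end AlmostAffineLocus

theorem IsDefinableFunOn.exists_defMap {L : FirstOrder.Language.{u₁, u₂}} {K : Type w} [Zero K]
    [L.Structure K] {n : ℕ} {X : Set ((Fin n → K) × K)} {f : (Fin n → K) → K → K}
    (hf : IsDefinableFunOn L X f) (hX : DefPred L K fun p => p ∈ X) :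
    ∃ g : (Fin n → K) × K → K, DefMap L K g ∧
      ∀ w, Set.EqOn (f w) (fun x => g (w, x)) (fiber X w) := by
  classical
  let g (p : (Fin n → K) × K) : K := if p ∈ X then f p.1 p.2 else 0
  have hgraph : DefPred L K fun p : ((Fin n → K) × K) × K => p.1 ∈ X ∧ p.2 = f p.1.1 p.1.2 :=
    Set.Definable.preimage_comp
      (Sum.elim (fun i => Sum.inl (Sum.inl i)) ![Sum.inl (Sum.inr ()), Sum.inr ()]) hf
  have graph_iff (p : ((Fin n → K) × K) × K) :
      p.2 = g p.1 ↔ (p.1 ∈ X ∧ p.2 = f p.1.1 p.1.2) ∨ (p.1 ∉ X ∧ p.2 = 0) := by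
    by_cases h : p.1 ∈ X <;> simp [g, h]
  refine ⟨g, .of_graph ?_, fun w x hx => (if_pos hx).symm⟩
  simp only [graph_iff]
  exact hgraph.or (.and (.not hX.comp) DefMap.eq)

theorem mainTheorem8 {L : FirstOrder.Language.{u₁, u₂}} (φ : Ldiv →ᴸ L)
    {K : Type w} [Field K] [IsAlgClosed K] [CharZero K] [L.Structure K]
    {Γ : Type w'} [AddCommGroup Γ] [LinearOrder Γ] [IsOrderedAddMonoid Γ] [Nontrivial Γ]
    (v : AddValuation K (WithTop Γ)) (hv : Function.Surjective v)
    (hexp : ExpandsValuedField φ v)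
    (hmin : IsCMinimal φ K)
    (hcomplete : IsDefinablyComplete v L)
    (hlin : ∀ g : Γ → Γ, IsDefinableGammaFun v L g → EventuallyQLinear g)
    {n : ℕ} (W : Set (Fin n → K)) (X : Set ((Fin n → K) × K)) (f : (Fin n → K) → K → K)
    (hX : IsDefinableFamily L W X) (hf : IsDefinableFunOn L X f)
    (hiso : ∀ w ∈ W, IsLocalCIsoOn v (f w) (fiber X w)) :
    ∃ F : Set ((Fin n → K) × K), F ⊆ X ∧ DefinableProd L F ∧
      ∀ w ∈ W, (fiber F w).Finite ∧
        HasLocallyJacobianProperty v (f w) (fiber X w \ fiber F w) := by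
  have : Fact (Function.Surjective v) := ⟨hv⟩
  have : DefinableField L K := hexp.definableField
  have : DefinableValuation L v := hexp.definableValuation
  have : UniformlyCMinimal L v := hmin.uniformlyCMinimal hexp
  have : QLinearValueGroup L v := ⟨hlin⟩
  have hXdef := definableProd_iff_defPred.1 hX.total
  obtain ⟨g, hg, hfg⟩ := hf.exists_defMap hXdef
  let locus (w : Fin n → K) : Set K := almostAffineLocus v (fun x => g (w, x)) (fiber X w)
  let F : Set ((Fin n → K) × K) := {p | p ∈ X ∧ p.2 ∉ locus p.1}
  have hF : DefPred L K fun p => p ∈ F := hXdef.and (hXdef.mem_almostAffineLocus hg).not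
  refine ⟨F, fun p hp => hp.1, definableProd_iff_defPred.2 hF, fun w hw => ?_⟩
  have hgw : DefMap L K fun x => g (w, x) := by fun_prop
  have hisog := (hiso w hw).congr (hfg w)
  have hsub : locus w ⊆ fiber X w := almostAffineLocus_subset
  refine ⟨hisog.finite_sdiff_almostAffineLocus hgw hF.comp, ?_⟩
  rw [show fiber X w \ fiber F w = locus w from sdiff_sdiff_eq_self hsub]
  exact (hisog.hasLocallyJacobianProperty hgw hcomplete).congr ((hfg w).symm.mono hsub)
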